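/- Let $K$ be a $2$-adic field, i.e. a finite extension of $\mathbb{Q}_2$, with ring of integers $\mathcal{O}_K$. Let $q$ be the cardinality of its residue field, $e_K$ its absolute ramification index $e(K/\mathbb{Q}_2)$, and $v_K$ its normalised valuation. For a group $G$, let $\Sigma^{G}$ be the set of $K$-isomorphism classes of totally ramified quartic field extensions $L/K$ such that $\mathrm{Gal}(\widetilde{L}/K) \cong G$, where $\widetilde{L}$ is the normal closure of $L$ over $K$. For a finite set $S$ of isomorphism classes of finite extensions of $K$, define its mass by $$ \widetilde{m}(S) = \sum_{L \in S} \frac{(\#\mathrm{Aut}(L/K))^{-1}}{q^{v_K(d_{L/K})}}, $$ where $d_{L/K}$ is the discriminant ideal of $L/K$. Let $D_4$ be the dihedral group of order $8$, $C_4$ the cyclic group of order $4$, and $V_4$ the Klein four-group. Then the sets $\Sigma^{D_4}$, $\Sigma^{C_4}$ and $\Sigma^{V_4}$ are finite, and $$ \widetilde{m}(\Sigma^{D_4}) = \frac{1}{q^2+q+1}\cdot\left(q^{-3e_K-3} + q^{-3e_K-1} + q^{-2}\right) - \widetilde{m}(\Sigma^{C_4}) - 3\,\widetilde{m}(\Sigma^{V_4}).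 $$ -/

import Mathlib

/-! Totally ramified quartic extensions of a `2`-adic field `K`, i.e. of a finite extension of `ℚ_[2]`,
and their mass. The ring of integers of `K` is the integral closure of `ℤ_[2]` in `K`; an extension of
`K` of finite degree is taken inside the algebraic closure of `K`, up to `K`-isomorphism. -/

namespace TwoAdic

section Base

variable (K : Type*) [Field K] [Algebra ℤ_[2] K]

/-- The ring of integers `𝒪_K` of a `2`-adic field `K`, as a `ℤ_[2]`-subalgebra of `K`. -/
noncomputable abbrev integers : Subalgebra ℤ_[2] K := integralClosure ℤ_[2] K

section Extension

variable (L : Type*) [Field L] [Algebra K L]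

/-- The ring of integers of an extension `L` of `K`, as an `𝒪_K`-subalgebra of `L`: the integral closure
of `𝒪_K` in `L`. -/
noncomputable abbrev integersOver : Subalgebra (integers K) L := integralClosure (integers K) L

/-- `L/K` is totally ramified: the ramification index over `K` of the maximal ideal of `𝒪_L` is the degree
of `L/K`. (For a finite extension `L/K` there is exactly one maximal ideal.) -/
def IsTotallyRamified : Prop :=
  ∀ P : Ideal (integersOver K L), P.IsMaximal →
    P.ramificationIdx (integers K) = Module.finrank K L

/-- The discriminant ideal `d_{L/K}` of a finite extension `L/K`: the ideal of `𝒪_K` generated by the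
discriminants `det (Tr (bᵢ bⱼ))` of all `[L : K]`-tuples `b` of elements of `𝒪_L`. -/
noncomputable def discrIdeal : Ideal (integers K) :=
  Ideal.span (Set.range fun b : Fin (Module.finrank K L) → integersOver K L =>
    Algebra.discr (integers K) b)

end Extension

variable {K} in
theorem discrIdeal_le {L L' : Type*} [Field L] [Algebra K L] [Field L'] [Algebra K L']
    (f : L ≃ₐ[K] L') : discrIdeal K L ≤ discrIdeal K L' := by
  refine Ideal.span_le.2 ?_
  rintro _ ⟨b, rfl⟩
  let g : integersOver K L ≃ₐ[integers K] integersOver K L' :=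
    (f.restrictScalars (integers K)).mapIntegralClosure
  let r : Fin (Module.finrank K L) ≃ Fin (Module.finrank K L') :=
    finCongr f.toLinearEquiv.finrank_eq
  refine Ideal.subset_span ⟨(g ∘ b) ∘ r.symm, ?_⟩
  change Algebra.discr (integers K) ((g ∘ b) ∘ r.symm) = Algebra.discr (integers K) b
  rw [Algebra.discr_eq_discr_of_algEquiv b g]
  simp only [Algebra.discr_def]
  exact Matrix.det_submatrix_equiv_self r.symm (Algebra.traceMatrix (integers K) (g ∘ b))

variable {K} in
theorem discrIdeal_congr {L L' : Type*} [Field L] [Algebra K L] [Field L'] [Algebra K L']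
    (e : L ≃ₐ[K] L') : discrIdeal K L = discrIdeal K L' :=
  le_antisymm (discrIdeal_le e) (discrIdeal_le e.symm)

/-- Isomorphism of extensions of `K`, for subextensions of the algebraic closure of `K`. -/
instance extensionSetoid : Setoid (IntermediateField K (AlgebraicClosure K)) where
  r L L' := Nonempty (L ≃ₐ[K] L')
  iseqv := ⟨fun _ => ⟨AlgEquiv.refl⟩, fun ⟨e⟩ => ⟨e.symm⟩, fun ⟨e⟩ ⟨f⟩ => ⟨e.trans f⟩⟩

/-- Isomorphism classes of algebraic extensions of `K`. -/
abbrev ExtensionClass : Type _ := Quotient (extensionSetoid K)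

/-- The Galois closure group `Gal(L̃/K)` of `L/K`, where `L̃` is the normal closure of `L` over `K`. -/
abbrev GaloisClosureGroup (L : IntermediateField K (AlgebraicClosure K)) : Type _ :=
  Gal(IntermediateField.normalClosure K L (AlgebraicClosure K)/K)

variable [Algebra ℚ_[2] K] [IsScalarTower ℤ_[2] ℚ_[2] K]

variable {K} in
/-- An element of an algebraic extension of `ℚ_[2]` is integral over `ℤ_[2]` if and only if its
spectral norm (the unique extension of the `2`-adic absolute value) is at most `1`. -/
theorem isIntegral_iff_spectralNorm_le_one [Algebra.IsAlgebraic ℚ_[2] K] (x : K) :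
    IsIntegral ℤ_[2] x ↔ spectralNorm ℚ_[2] K x ≤ 1 := by
  have hx : IsIntegral ℚ_[2] x := (Algebra.IsAlgebraic.isAlgebraic x).isIntegral
  rw [spectralNorm, spectralValue_le_one_iff (minpoly.monic hx)]
  constructor
  · intro h n
    rw [minpoly.isIntegrallyClosed_eq_field_fractions' ℚ_[2] h, Polynomial.coeff_map]
    exact PadicInt.norm_le_one _
  · intro h
    have hl : minpoly ℚ_[2] x ∈ Polynomial.lifts (algebraMap ℤ_[2] ℚ_[2]) := by
      rw [Polynomial.lifts_iff_coeff_lifts]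
      exact fun n => ⟨⟨_, h n⟩, rfl⟩
    obtain ⟨p, hp, -, hm⟩ := Polynomial.lifts_and_natDegree_eq_and_monic hl (minpoly.monic hx)
    refine ⟨p, hm, ?_⟩
    rw [← Polynomial.aeval_def, ← Polynomial.aeval_map_algebraMap ℚ_[2], hp, minpoly.aeval]

/-- The ring of integers of a `2`-adic field is a local ring. -/
instance isLocalRing_integers [Algebra.IsAlgebraic ℚ_[2] K] : IsLocalRing (integers K) := by
  have key : ∀ a : integers K, IsUnit a ↔ spectralNorm ℚ_[2] K (a : K) = 1 := by
    intro a
    have ha := (isIntegral_iff_spectralNorm_le_one (a : K)).1 a.2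
    constructor
    · rintro ⟨u, rfl⟩
      have hi := (isIntegral_iff_spectralNorm_le_one
        (((u⁻¹ : (integers K)ˣ) : integers K) : K)).1 (Subtype.property _)
      have hmul : ((u : integers K) : K) * (((u⁻¹ : (integers K)ˣ) : integers K) : K) = 1 := by
        exact_mod_cast congrArg (Subtype.val) u.mul_inv
      have h1 := map_mul (spectralMulAlgNorm ℚ_[2] K) ((u : integers K) : K)
        (((u⁻¹ : (integers K)ˣ) : integers K) : K)
      rw [hmul, map_one] at h1
      simp only [spectralMulAlgNorm_def] at h1
      have h0 := spectralNorm_nonneg (K := ℚ_[2]) ((u : integers K) : K)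
      nlinarith
    · intro h
      have hne : (a : K) ≠ 0 := by
        intro h0
        rw [h0, spectralNorm_zero] at h
        exact zero_ne_one h
      have h1 := map_mul (spectralMulAlgNorm ℚ_[2] K) (a : K) (a : K)⁻¹
      rw [mul_inv_cancel₀ hne, map_one] at h1
      simp only [spectralMulAlgNorm_def] at h1
      rw [h, one_mul] at h1
      exact IsUnit.of_mul_eq_one
        (⟨(a : K)⁻¹, (isIntegral_iff_spectralNorm_le_one _).2 h1.symm.le⟩ : integers K)
        (Subtype.ext (mul_inv_cancel₀ hne))
  refine IsLocalRing.of_nonunits_add fun a b ha hb => ?_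
  rw [mem_nonunits_iff, key] at ha hb ⊢
  have ha' := lt_of_le_of_ne ((isIntegral_iff_spectralNorm_le_one (a : K)).1 a.2) ha
  have hb' := lt_of_le_of_ne ((isIntegral_iff_spectralNorm_le_one (b : K)).1 b.2) hb
  have := isNonarchimedean_spectralNorm (K := ℚ_[2]) (L := K) (a : K) (b : K)
  exact (lt_of_le_of_lt this (max_lt ha' hb')).ne

variable [FiniteDimensional ℚ_[2] K]

/-- The cardinality `q_K` of the residue field of `K`. -/
noncomputable def residueCard : ℕ := Nat.card (IsLocalRing.ResidueField (integers K))

/-- The absolute ramification index `e_K = e(K/ℚ₂)`. -/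
noncomputable def absRamificationIdx : ℕ :=
  (IsLocalRing.maximalIdeal (integers K)).ramificationIdx ℤ_[2]

section Extension

variable (L : Type*) [Field L] [Algebra K L]

/-- `v_K(d_{L/K})`: the exponent of the maximal ideal of `𝒪_K` in the discriminant ideal of `L/K`. -/
noncomputable def discrVal : ℕ :=
  multiplicity (IsLocalRing.maximalIdeal (integers K)) (discrIdeal K L)

/-- The contribution `(#Aut(L/K))⁻¹ / q^{v_K(d_{L/K})}` of `L` to the mass. -/
noncomputable def weight : ℝ :=
  (Nat.card (L ≃ₐ[K] L) : ℝ)⁻¹ / (residueCard K : ℝ) ^ discrVal K L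

end Extension

variable {K} in
theorem weight_congr {L L' : Type*} [Field L] [Algebra K L] [Field L'] [Algebra K L']
    (e : L ≃ₐ[K] L') : weight K L = weight K L' := by
  have h : Nat.card (L ≃ₐ[K] L) = Nat.card (L' ≃ₐ[K] L') := Nat.card_congr e.autCongr.toEquiv
  simp only [weight, discrVal, discrIdeal_congr e, h]

/-- `Σ^G`: the isomorphism classes of totally ramified quartic extensions `L/K` whose Galois closure
group is isomorphic to `G`. -/
def quartics (G : Type*) [Group G] : Set (ExtensionClass K) :=
  {c | ∃ L : IntermediateField K (AlgebraicClosure K), Quotient.mk (extensionSetoid K) L = c ∧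
    Module.finrank K L = 4 ∧ IsTotallyRamified K L ∧ Nonempty (GaloisClosureGroup K L ≃* G)}

/-- The contribution of an isomorphism class of extensions to the mass. -/
noncomputable def classWeight (c : ExtensionClass K) : ℝ :=
  Quotient.lift (fun L : IntermediateField K (AlgebraicClosure K) => weight K L)
    (fun _ _ h => Nonempty.elim h weight_congr) c

/-- The mass `m̃(S) = ∑_{L ∈ S} (#Aut(L/K))⁻¹ / q^{v_K(d_{L/K})}` of a (finite) set `S` of isomorphism
classes of extensions of `K`. -/
noncomputable def mass (S : Set (ExtensionClass K)) : ℝ := ∑ᶠ c ∈ S, classWeight K c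

end Base

/-- The cyclic group of order `4`. -/
abbrev C4 : Type := Multiplicative (ZMod 4)

/-- The Klein four-group. -/
abbrev V4 : Type := Multiplicative (ZMod 2 × ZMod 2)

/-- The dihedral group of order `8`. -/
abbrev D4 : Type := DihedralGroup 4

end TwoAdic

/-!
Count the towers `K ⊂ E ⊂ L` of quadratic extensions with `L/K` totally ramified, weighting each by
`q ^ (-v_K(d_{L/K}))`.

By the Galois correspondence, a quartic extension `L/K` has a quadratic subextension exactly when
the Galois group of its normal closure is `D₄`, `C₄` or `V₄`, and the number of quadratic
subextensions is then `1`, `1` and `3`. By orbit–stabiliser, summing over the subfields `L` of the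
algebraic closure gives `4` times the mass. So the weighted count of towers is
`4 * (m̃(Σ^D₄) + m̃(Σ^C₄) + 3 * m̃(Σ^V₄))`.

On the other hand, a ramified quadratic extension of a dyadic field with residue cardinality `q` and
ramification index `e` has discriminant exponent `2 * i` with `1 ≤ i ≤ e`, or `2 * e + 1`. Filtering
the square classes by their distance to the squares shows that `2 * (q - 1) * q ^ (i - 1)`
extensions have exponent `2 * i` and `2 * q ^ e` have exponent `2 * e + 1`. This applies to `E/K`
with `(q, e)` and to `L/E` with `(q, 2 * e)`. Since
`v_K(d_{L/K}) = 2 * v_K(d_{E/K}) + v_E(d_{L/E})`, the weighted count of towers is a product of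
geometric sums.
-/

namespace TwoAdic

section UnitBall

variable {F : Type*} [Field F] {v : AbsoluteValue F ℝ}

theorem map_sub_le_max (hv : IsNonarchimedean v) (x y : F) : v (x - y) ≤ max (v x) (v y) := by
  simpa only [sub_eq_add_neg, v.map_neg] using hv x (-y)

theorem map_one_add_of_lt_one (hv : IsNonarchimedean v) {x : F} (hx : v x < 1) : v (1 + x) = 1 := by
  rw [hv.add_eq_left_of_lt (by rwa [map_one]), map_one]

variable (v) in
/-- The unit ball of a nonarchimedean absolute value, as a valuation ring. -/
def unitBall (hv : IsNonarchimedean v) : ValuationSubring F where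
  carrier := {x | v x ≤ 1}
  mul_mem' {a b} ha hb := by
    simp only [Set.mem_ofPred_eq, map_mul] at *
    exact mul_le_one₀ ha (v.nonneg b) hb
  one_mem' := by simp
  add_mem' {a b} ha hb := (hv a b).trans (max_le ha hb)
  zero_mem' := by simp
  neg_mem' {a} ha := by simpa using ha
  mem_or_inv_mem' x := by
    simp only [Set.mem_ofPred_eq, map_inv₀]
    exact (le_total (v x) 1).imp id fun h => inv_le_one_of_one_le₀ h

variable {hv : IsNonarchimedean v}

theorem mem_unitBall {x : F} : x ∈ unitBall v hv ↔ v x ≤ 1 := Iff.rfl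

theorem isUnit_unitBall (x : unitBall v hv) : IsUnit x ↔ v (x : F) = 1 := by
  constructor
  · rintro ⟨u, rfl⟩
    have hmul : v ((u : unitBall v hv) : F) * v ((↑u⁻¹ : unitBall v hv) : F) = 1 := by
      rw [← map_mul, ← map_one v]
      exact congrArg v (by exact_mod_cast congrArg Subtype.val u.mul_inv)
    have hu : v ((u : unitBall v hv) : F) ≤ 1 := (u : unitBall v hv).2
    have hu' : v ((↑u⁻¹ : unitBall v hv) : F) ≤ 1 := (↑u⁻¹ : unitBall v hv).2
    nlinarith [v.nonneg ((u : unitBall v hv) : F)]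
  · intro h
    have hx : (x : F) ≠ 0 := v.ne_zero_iff.1 (by simp [h])
    exact IsUnit.of_mul_eq_one ⟨(x : F)⁻¹, by rw [mem_unitBall, map_inv₀, h, inv_one]⟩
      (Subtype.ext (mul_inv_cancel₀ hx))

theorem mem_maximalIdeal_unitBall (x : unitBall v hv) :
    x ∈ IsLocalRing.maximalIdeal (unitBall v hv) ↔ v (x : F) < 1 := by
  rw [IsLocalRing.mem_maximalIdeal, mem_nonunits_iff, isUnit_unitBall]
  exact ⟨fun h => lt_of_le_of_ne x.2 h, fun h => h.ne⟩

variable (v hv) in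
/-- The residue field of a nonarchimedean absolute value. -/
abbrev residueOf : Type _ := IsLocalRing.ResidueField (unitBall v hv)

theorem residue_unitBall_eq_iff (x y : unitBall v hv) :
    IsLocalRing.residue _ x = IsLocalRing.residue _ y ↔ v ((x : F) - y) < 1 := by
  rw [← sub_eq_zero, ← map_sub, IsLocalRing.residue_eq_zero_iff, mem_maximalIdeal_unitBall]
  rfl

end UnitBall

/-! ### Square classes of a dyadic field -/

section SquareClass

variable {F : Type*} [Field F]

variable (F) in
/-- The group `Fˣ / (Fˣ)²` of square classes of `F`. -/
abbrev SquareClass : Type _ := Fˣ ⧸ Subgroup.square Fˣ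

/-- The class of a unit modulo squares. -/
noncomputable def sqClass : Fˣ →* SquareClass F := QuotientGroup.mk' (Subgroup.square Fˣ)

theorem sqClass_surjective : Function.Surjective (sqClass (F := F)) :=
  QuotientGroup.mk'_surjective _

theorem sqClass_eq_one_iff {u : Fˣ} : sqClass u = 1 ↔ IsSquare u :=
  (QuotientGroup.eq_one_iff u).trans Subgroup.mem_square

theorem sqClass_eq_iff {u w : Fˣ} : sqClass u = sqClass w ↔ ∃ s : Fˣ, u = w * s ^ 2 := by
  rw [eq_comm, ← inv_mul_eq_one, ← map_inv, ← map_mul, sqClass_eq_one_iff, isSquare_iff_exists_sq]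
  exact exists_congr fun s => inv_mul_eq_iff_eq_mul

end SquareClass

section ArtinSchreier

variable (k : Type*) [Field k] [CharP k 2]

/-- The Artin–Schreier homomorphism `x ↦ x² + x` of a field of characteristic `2`. -/
def artinSchreier : k →+ k :=
  AddMonoidHom.mk' (fun x => x ^ 2 + x) fun x y => by rw [CharTwo.add_sq]; ring

variable {k} in
theorem artinSchreier_apply (x : k) : artinSchreier k x = x ^ 2 + x := rfl

theorem coe_ker_artinSchreier : ((artinSchreier k).ker : Set k) = {0, 1} := by
  ext x
  rw [SetLike.mem_coe, AddMonoidHom.mem_ker, artinSchreier_apply, sq, ← mul_add_one, mul_eq_zero,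
    CharTwo.add_eq_zero]
  rfl

theorem index_range_artinSchreier [Finite k] :
    (artinSchreier k).toMultiplicative.range.index = 2 := by
  change (artinSchreier k).range.toSubgroup.index = 2
  rw [AddSubgroup.index_toSubgroup, AddSubgroup.index_range, ← SetLike.coe_sort_coe,
    Nat.card_coe_set_eq, coe_ker_artinSchreier, Set.ncard_pair zero_ne_one]

end ArtinSchreier

/-- The absolute value `v` is discrete with value group generated by `ρ < 1`, its residue field is
finite with `q` elements, `v 2 = ρ ^ e` with `0 < e`, and the consequence of Hensel's lemma needed
for square roots holds: Artin–Schreier equations with small right-hand side are solvable. -/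
structure IsDyadic {F : Type*} [Field F] (v : AbsoluteValue F ℝ) (ρ : ℝ) (q e : ℕ) : Prop where
  nonarch : IsNonarchimedean v
  pos : 0 < ρ
  lt_one : ρ < 1
  exists_uniformizer : ∃ π, v π = ρ
  exists_zpow : ∀ x, x ≠ 0 → ∃ n : ℤ, v x = ρ ^ n
  map_two : v 2 = ρ ^ e
  e_pos : 0 < e
  finite_residue : Finite (residueOf v nonarch)
  card_residue : Nat.card (residueOf v nonarch) = q
  exists_artinSchreier : ∀ c, v c < 1 → ∃ y, y ^ 2 + y = c

namespace IsDyadic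

variable {F : Type*} [Field F] {v : AbsoluteValue F ℝ} {ρ : ℝ} {q e : ℕ}

section Values

variable (h : IsDyadic v ρ q e)

include h

theorem zpow_lt_zpow_iff {m n : ℤ} : ρ ^ m < ρ ^ n ↔ n < m :=
  zpow_lt_zpow_iff_right_of_lt_one₀ h.pos h.lt_one

theorem zpow_le_zpow_iff {m n : ℤ} : ρ ^ m ≤ ρ ^ n ↔ n ≤ m :=
  zpow_le_zpow_iff_right_of_lt_one₀ h.pos h.lt_one

theorem pow_lt_pow_iff {m n : ℕ} : ρ ^ m < ρ ^ n ↔ n < m :=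
  pow_lt_pow_iff_right_of_lt_one₀ h.pos h.lt_one

theorem pow_le_pow_iff {m n : ℕ} : ρ ^ m ≤ ρ ^ n ↔ n ≤ m :=
  pow_le_pow_iff_right_of_lt_one₀ h.pos h.lt_one

theorem pow_lt_one {n : ℕ} (hn : 0 < n) : ρ ^ n < 1 :=
  pow_lt_one₀ h.pos.le h.lt_one hn.ne'

theorem zpow_inj {m n : ℤ} (hmn : ρ ^ m = ρ ^ n) : m = n :=
  zpow_right_injective₀ h.pos h.lt_one.ne hmn

theorem exists_unit_zpow (n : ℤ) : ∃ w : Fˣ, v w = ρ ^ n := by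
  obtain ⟨π, hπ⟩ := h.exists_uniformizer
  have hπ0 : π ≠ 0 := v.ne_zero_iff.1 (hπ ▸ h.pos.ne')
  exact ⟨Units.mk0 π hπ0 ^ n, by rw [Units.val_zpow_eq_zpow_val, map_zpow₀, Units.val_mk0, hπ]⟩

theorem exists_eq_pow (n : ℕ) : ∃ c, v c = ρ ^ n := by
  obtain ⟨w, hw⟩ := h.exists_unit_zpow n
  exact ⟨w, by rw [hw, zpow_natCast]⟩

theorem le_zpow_of_lt {x : F} {j : ℤ} (hx : v x < ρ ^ j) : v x ≤ ρ ^ (j + 1) := by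
  rcases eq_or_ne x 0 with rfl | hx0
  · simpa using (zpow_pos h.pos _).le
  · obtain ⟨n, hn⟩ := h.exists_zpow x hx0
    rw [hn, h.zpow_lt_zpow_iff] at hx
    rwa [hn, h.zpow_le_zpow_iff]

theorem le_pow_of_lt {x : F} {j : ℕ} (hx : v x < ρ ^ j) : v x ≤ ρ ^ (j + 1) := by
  exact_mod_cast h.le_zpow_of_lt (x := x) (j := j) (by exact_mod_cast hx)

theorem two_ne_zero : (2 : F) ≠ 0 := v.ne_zero_iff.1 (h.map_two ▸ (pow_pos h.pos e).ne')

theorem four_ne_zero : (4 : F) ≠ 0 := by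
  simpa [show (4 : F) = 2 ^ 2 by norm_num] using h.two_ne_zero

theorem map_two_lt_one : v 2 < 1 := h.map_two ▸ h.pow_lt_one h.e_pos

theorem map_four : v 4 = ρ ^ (2 * e) := by
  rw [show (4 : F) = 2 ^ 2 by norm_num, map_pow, h.map_two, ← pow_mul, mul_comm]

theorem charP_residue : CharP (residueOf v h.nonarch) 2 := by
  refine CharTwo.of_one_ne_zero_of_two_eq_zero one_ne_zero ?_
  rw [← map_ofNat (IsLocalRing.residue (unitBall v h.nonarch)) 2, IsLocalRing.residue_eq_zero_iff,
    mem_maximalIdeal_unitBall]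
  exact h.map_two_lt_one

theorem q_pos : 0 < q := by
  have := h.finite_residue
  exact h.card_residue ▸ Nat.card_pos

theorem exists_sub_sq_lt_one {x : F} (hx : v x ≤ 1) : ∃ s, v s ≤ 1 ∧ v (x - s ^ 2) < 1 := by
  have := h.charP_residue
  have := h.finite_residue
  obtain ⟨t, ht⟩ := surjective_frobenius (residueOf v h.nonarch) 2
    (IsLocalRing.residue (unitBall v h.nonarch) ⟨x, hx⟩)
  obtain ⟨s, rfl⟩ := IsLocalRing.residue_surjective t
  rw [frobenius_def, ← map_pow, eq_comm, residue_unitBall_eq_iff] at ht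
  exact ⟨s, s.2, ht⟩

end Values

/-- The filtration `U_j = {u | v u = 1, v (u - 1) ≤ ρ ^ j}` of the group of units. -/
def unitFiltration (h : IsDyadic v ρ q e) (j : ℕ) : Subgroup Fˣ where
  carrier := {u | v u = 1 ∧ v ((u : F) - 1) ≤ ρ ^ j}
  mul_mem' {a b} ha hb := by
    refine ⟨by simp [ha.1, hb.1], ?_⟩
    have hab : ((a * b : Fˣ) : F) - 1 = a * (b - 1) + (a - 1) := by push_cast; ring
    rw [hab]
    refine (h.nonarch _ _).trans (max_le ?_ ha.2)
    rw [map_mul, ha.1, one_mul]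
    exact hb.2
  one_mem' := ⟨by simp, by simpa using (pow_pos h.pos j).le⟩
  inv_mem' {a} ha := by
    refine ⟨by simp [ha.1], ?_⟩
    have hinv : ((a⁻¹ : Fˣ) : F) - 1 = -(a : F)⁻¹ * (a - 1) := by
      have := a.ne_zero
      push_cast; field_simp; ring
    rw [hinv, map_mul, v.map_neg, map_inv₀, ha.1, inv_one, one_mul]
    exact ha.2

/-- The image in the group of square classes of the filtration of the units. -/
noncomputable def classFiltration (h : IsDyadic v ρ q e) (j : ℕ) : Subgroup (SquareClass F) :=
  (h.unitFiltration j).map sqClass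

section Filtration

variable (h : IsDyadic v ρ q e)

theorem mem_unitFiltration {u : Fˣ} {j : ℕ} :
    u ∈ h.unitFiltration j ↔ v (u : F) = 1 ∧ v ((u : F) - 1) ≤ ρ ^ j := Iff.rfl

theorem unitFiltration_antitone : Antitone h.unitFiltration :=
  fun _ _ hij _ hu => ⟨hu.1, hu.2.trans (h.pow_le_pow_iff.2 hij)⟩

theorem exists_mem_unitFiltration_eq_one_add {j : ℕ} (hj : 0 < j) {x : F} (hx : v x ≤ ρ ^ j) :
    ∃ u ∈ h.unitFiltration j, (u : F) = 1 + x := by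
  have h1 := map_one_add_of_lt_one h.nonarch (hx.trans_lt (h.pow_lt_one hj))
  exact ⟨Units.mk0 (1 + x) (v.ne_zero_iff.1 (by simp [h1])),
    ⟨h1, by rwa [Units.val_mk0, add_sub_cancel_left]⟩, rfl⟩

theorem classFiltration_antitone : Antitone h.classFiltration :=
  fun _ _ hij => Subgroup.map_mono (h.unitFiltration_antitone hij)

theorem sqClass_mem_classFiltration {u : Fˣ} {j : ℕ} :
    sqClass u ∈ h.classFiltration j ↔ ∃ w ∈ h.unitFiltration j, ∃ s : Fˣ, u = w * s ^ 2 := by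
  simp only [classFiltration, Subgroup.mem_map]
  exact exists_congr fun w => and_congr_right fun _ => by rw [eq_comm, sqClass_eq_iff]

theorem sqClass_mem_classFiltration_of_sub_sq_lt {u : Fˣ} (hu : v (u : F) = 1) {t : F}
    (ht : v t = 1) {j : ℕ} (hut : v (u - t ^ 2) < ρ ^ j) :
    sqClass u ∈ h.classFiltration (j + 1) := by
  have ht0 : t ≠ 0 := v.ne_zero_iff.1 (by simp [ht])
  refine h.sqClass_mem_classFiltration.2
    ⟨u * (Units.mk0 t ht0 ^ 2)⁻¹, ⟨by simp [hu, ht], ?_⟩, Units.mk0 t ht0, by group⟩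
  have hdiv : ((u * (Units.mk0 t ht0 ^ 2)⁻¹ : Fˣ) : F) - 1 = (t ^ 2)⁻¹ * (u - t ^ 2) := by
    push_cast; simp; field_simp
  rw [hdiv, map_mul, map_inv₀, map_pow, ht, one_pow, inv_one, one_mul]
  exact h.le_pow_of_lt hut

include h in
theorem exists_sub_sq_lt {u : Fˣ} {k : ℕ} (hk : k < e) (hu : u ∈ h.unitFiltration (2 * k)) :
    ∃ t : F, v t = 1 ∧ v (u - t ^ 2) < ρ ^ (2 * k) := by
  rcases Nat.eq_zero_or_pos k with rfl | hk0
  · obtain ⟨s, -, hs⟩ := h.exists_sub_sq_lt_one hu.1.le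
    refine ⟨s, ?_, by simpa using hs⟩
    have hs1 : v (s ^ 2) = 1 := by
      rw [show s ^ 2 = u + -(u - s ^ 2) by ring, h.nonarch.add_eq_left_of_lt, hu.1]
      rwa [v.map_neg, hu.1]
    rwa [map_pow, pow_eq_one_iff_of_nonneg (v.nonneg s) (by norm_num)] at hs1
  obtain ⟨c, hc⟩ := h.exists_eq_pow k
  have hc0 : c ≠ 0 := v.ne_zero_iff.1 (hc ▸ (pow_pos h.pos k).ne')
  have hc2 : v (c ^ 2) = ρ ^ (2 * k) := by rw [map_pow, hc, ← pow_mul, mul_comm]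
  obtain ⟨s, hs1, hs⟩ := h.exists_sub_sq_lt_one (x := (u - 1) / c ^ 2) (by
    rw [map_div₀, hc2]
    exact (div_le_one (pow_pos h.pos _)).2 hu.2)
  have hcs : v (c * s) ≤ ρ ^ k := by
    rw [map_mul, hc]; exact mul_le_of_le_one_right (pow_pos h.pos k).le hs1
  refine ⟨1 + c * s, map_one_add_of_lt_one h.nonarch (hcs.trans_lt (h.pow_lt_one hk0)), ?_⟩
  have hsub : (u : F) - (1 + c * s) ^ 2 = c ^ 2 * ((u - 1) / c ^ 2 - s ^ 2) + -(2 * (c * s)) := by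
    field_simp; ring
  rw [hsub]
  refine (h.nonarch _ _).trans_lt (max_lt ?_ ?_)
  · rw [map_mul, hc2]
    exact mul_lt_of_lt_one_right (pow_pos h.pos _) hs
  · rw [v.map_neg, map_mul, h.map_two]
    calc ρ ^ e * v (c * s) ≤ ρ ^ e * ρ ^ k := mul_le_mul_of_nonneg_left hcs (pow_pos h.pos e).le
      _ = ρ ^ (e + k) := (pow_add _ _ _).symm
      _ < ρ ^ (2 * k) := h.pow_lt_pow_iff.2 (by lia)

theorem classFiltration_two_mul {k : ℕ} (hk : k < e) :
    h.classFiltration (2 * k) = h.classFiltration (2 * k + 1) := by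
  refine le_antisymm ?_ (h.classFiltration_antitone (by lia))
  rintro _ ⟨u, hu, rfl⟩
  obtain ⟨t, ht, hut⟩ := h.exists_sub_sq_lt hk hu
  exact h.sqClass_mem_classFiltration_of_sub_sq_lt hu.1 ht hut

include h in
theorem map_sq_sub_one_ne {k : ℕ} (hk : k < e) (s : F) : v (s ^ 2 - 1) ≠ ρ ^ (2 * k + 1) := by
  intro hs
  rw [show s ^ 2 - 1 = (s - 1) * (s - 1 + 2) by ring, map_mul] at hs
  rcases lt_or_ge (v 2) (v (s - 1)) with hlt | hle
  · rw [h.nonarch.add_eq_left_of_lt hlt] at hs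
    obtain ⟨n, hn⟩ := h.exists_zpow (s - 1) (v.ne_zero_iff.1 ((v.nonneg 2).trans_lt hlt).ne')
    rw [hn, ← zpow_add₀ h.pos.ne', ← zpow_natCast] at hs
    have := h.zpow_inj hs
    lia
  · have hprod : v (s - 1) * v (s - 1 + 2) ≤ ρ ^ (2 * e) := by
      rw [two_mul, pow_add, ← h.map_two]
      exact mul_le_mul hle ((h.nonarch _ _).trans (max_le hle le_rfl)) (v.nonneg _) (v.nonneg _)
    rw [hs, h.pow_le_pow_iff] at hprod
    lia

theorem sqClass_notMem_classFiltration {u : Fˣ} {k : ℕ} (hk : k < e)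
    (hu : v ((u : F) - 1) = ρ ^ (2 * k + 1)) : sqClass u ∉ h.classFiltration (2 * k + 2) := by
  rw [sqClass_mem_classFiltration]
  rintro ⟨w, hw, s, rfl⟩
  apply h.map_sq_sub_one_ne hk s
  have hws : v ((w : F) * s ^ 2) = 1 := by
    have := map_one_add_of_lt_one h.nonarch (hu.trans_lt (h.pow_lt_one (by lia)))
    simpa using this
  have hs : v (s : F) ^ 2 = 1 := by rwa [map_mul, hw.1, one_mul, map_pow] at hws
  have hsub : (s : F) ^ 2 - 1 = (((w * s ^ 2 : Fˣ) : F) - 1) + -((w - 1) * (s : F) ^ 2) := by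
    push_cast; ring
  rw [hsub, h.nonarch.add_eq_left_of_lt, hu]
  rw [v.map_neg, map_mul, map_pow, hs, mul_one, hu]
  exact hw.2.trans_lt (h.pow_lt_pow_iff.2 (by lia))

theorem sqClass_mem_classFiltration_zero {u : Fˣ} :
    sqClass u ∈ h.classFiltration 0 ↔ ∃ m : ℤ, v (u : F) = ρ ^ (2 * m) := by
  rw [sqClass_mem_classFiltration]
  constructor
  · rintro ⟨w, hw, s, rfl⟩
    obtain ⟨m, hm⟩ := h.exists_zpow s s.ne_zero
    refine ⟨m, ?_⟩
    rw [Units.val_mul, map_mul, hw.1, one_mul, Units.val_pow_eq_pow_val, map_pow, hm, mul_comm,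
      zpow_mul, zpow_ofNat]
  · rintro ⟨m, hm⟩
    obtain ⟨s, hs⟩ := h.exists_unit_zpow m
    have hus : v ((u * (s ^ 2)⁻¹ : Fˣ) : F) = 1 := by
      rw [Units.val_mul, map_mul, hm, Units.val_inv_eq_inv_val, map_inv₀, Units.val_pow_eq_pow_val,
        map_pow, hs, ← zpow_ofNat, ← zpow_mul, mul_comm m, mul_inv_cancel₀ (zpow_pos h.pos _).ne']
    refine ⟨u * (s ^ 2)⁻¹, ⟨hus, (map_sub_le_max h.nonarch _ _).trans ?_⟩, s, by group⟩
    rw [hus, map_one, max_self, pow_zero]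

theorem index_classFiltration_zero : (h.classFiltration 0).index = 2 := by
  obtain ⟨w, hw⟩ := h.exists_unit_zpow 1
  rw [Subgroup.index_eq_two_iff]
  refine ⟨sqClass w, fun g => ?_⟩
  obtain ⟨u, rfl⟩ := sqClass_surjective g
  obtain ⟨n, hn⟩ := h.exists_zpow u u.ne_zero
  rw [← map_mul, h.sqClass_mem_classFiltration_zero, h.sqClass_mem_classFiltration_zero,
    Units.val_mul, map_mul, hw, hn, ← zpow_add₀ h.pos.ne']
  rcases Int.even_or_odd' n with ⟨m, rfl | rfl⟩
  · exact .inr ⟨⟨m, rfl⟩, fun ⟨m', hm'⟩ => by have := h.zpow_inj hm'; lia⟩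
  · exact .inl ⟨⟨m + 1, by congr 1; ring⟩, fun ⟨m', hm'⟩ => by have := h.zpow_inj hm'; lia⟩

end Filtration

variable {F : Type*} [Field F] {v : AbsoluteValue F ℝ} {ρ : ℝ} {q e : ℕ}
  (h : IsDyadic v ρ q e)

/-- The homomorphism `1 + c x ↦ x mod 𝔪` on `U_j`, where `v c = ρ ^ j`, to the (multiplicatively
written) residue field. -/
noncomputable def leadingCoeff {j : ℕ} (hj : 0 < j) {c : F} (hc : v c = ρ ^ j) :
    h.unitFiltration j →* Multiplicative (residueOf v h.nonarch) :=
  have hdiv {x : F} (hx : v x ≤ ρ ^ j) : v (x / c) ≤ 1 := by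
    rw [map_div₀, hc]
    exact (div_le_one (pow_pos h.pos j)).2 hx
  MonoidHom.mk' (fun u => .ofAdd (IsLocalRing.residue (unitBall v h.nonarch)
    ⟨((u : Fˣ) - 1 : F) / c, hdiv u.2.2⟩)) fun u w => by
  rw [← ofAdd_add, ← map_add, Equiv.apply_eq_iff_eq, residue_unitBall_eq_iff]
  have hc0 : c ≠ 0 := v.ne_zero_iff.1 (hc ▸ (pow_pos h.pos j).ne')
  have hprod : (((u * w : h.unitFiltration j) : Fˣ) - 1 : F) / c -
      (((u : Fˣ) - 1 : F) / c + ((w : Fˣ) - 1 : F) / c) =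
      ((u : Fˣ) - 1 : F) * (((w : Fˣ) - 1 : F) / c) := by
    push_cast; field_simp; ring
  exact hprod ▸ map_mul v _ _ ▸ mul_lt_one_of_nonneg_of_lt_one_left (v.nonneg _)
    (u.2.2.trans_lt (h.pow_lt_one hj)) (hdiv w.2.2)

theorem leadingCoeff_eq_iff {j : ℕ} (hj : 0 < j) {c : F} (hc : v c = ρ ^ j)
    (u : h.unitFiltration j) (x : unitBall v h.nonarch) :
    h.leadingCoeff hj hc u = .ofAdd (IsLocalRing.residue _ x) ↔
      v (((u : Fˣ) : F) - (1 + c * x)) < ρ ^ j := by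
  have hc0 : c ≠ 0 := v.ne_zero_iff.1 (hc ▸ (pow_pos h.pos j).ne')
  rw [leadingCoeff, MonoidHom.mk'_apply, Equiv.apply_eq_iff_eq, residue_unitBall_eq_iff,
    show ((u : Fˣ) : F) - (1 + c * x) = c * (((u : Fˣ) - 1 : F) / c - x) by field_simp; ring,
    map_mul, hc, mul_lt_iff_lt_one_right (pow_pos h.pos j)]

theorem leadingCoeff_surjective {j : ℕ} (hj : 0 < j) {c : F} (hc : v c = ρ ^ j) :
    Function.Surjective (h.leadingCoeff hj hc) := by
  intro a
  obtain ⟨x, hx⟩ := IsLocalRing.residue_surjective a.toAdd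
  obtain ⟨u, hu, hux⟩ := h.exists_mem_unitFiltration_eq_one_add hj (x := c * x) (by
    rw [map_mul, hc]
    exact mul_le_of_le_one_right (pow_pos h.pos j).le x.2)
  refine ⟨⟨u, hu⟩, ?_⟩
  rw [← ofAdd_toAdd a, ← hx, leadingCoeff_eq_iff, hux, sub_self, map_zero]
  exact pow_pos h.pos j

theorem ker_leadingCoeff {j : ℕ} (hj : 0 < j) {c : F} (hc : v c = ρ ^ j) :
    (h.leadingCoeff hj hc).ker = (h.unitFiltration (j + 1)).subgroupOf (h.unitFiltration j) := by
  ext u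
  rw [MonoidHom.mem_ker, ← ofAdd_zero, ← map_zero (IsLocalRing.residue _), leadingCoeff_eq_iff,
    Subgroup.mem_subgroupOf, mem_unitFiltration, ZeroMemClass.coe_zero, mul_zero, add_zero]
  exact ⟨fun hu => ⟨u.2.1, h.le_pow_of_lt hu⟩,
    fun hu => hu.2.trans_lt (h.pow_lt_pow_iff.2 j.lt_succ_self)⟩

theorem relIndex_unitFiltration_succ {j : ℕ} (hj : 0 < j) :
    (h.unitFiltration (j + 1)).relIndex (h.unitFiltration j) = q := by
  obtain ⟨c, hc⟩ := h.exists_eq_pow j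
  rw [Subgroup.relIndex, ← h.ker_leadingCoeff hj hc, Subgroup.index_ker,
    MonoidHom.range_eq_top.2 (h.leadingCoeff_surjective hj hc), Subgroup.card_top]
  exact h.card_residue

theorem comap_classFiltration_inf {k : ℕ} (hk : k < e) :
    (h.classFiltration (2 * k + 2)).comap sqClass ⊓ h.unitFiltration (2 * k + 1) =
      h.unitFiltration (2 * k + 2) := by
  refine le_antisymm ?_ (le_inf (Subgroup.le_comap_map _ _) (h.unitFiltration_antitone (by lia)))
  rintro u ⟨hu, hu1⟩
  refine ⟨hu1.1, h.le_pow_of_lt (lt_of_le_of_ne hu1.2 fun heq => ?_)⟩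
  exact h.sqClass_notMem_classFiltration hk heq hu

theorem card_classFiltration_odd {k : ℕ} (hk : k < e) :
    Nat.card (h.classFiltration (2 * k + 1)) = q * Nat.card (h.classFiltration (2 * k + 2)) := by
  have hrel : (h.classFiltration (2 * k + 2)).relIndex (h.classFiltration (2 * k + 1)) = q := by
    refine Eq.trans ?_ (h.relIndex_unitFiltration_succ (j := 2 * k + 1) (by lia))
    rw [← h.comap_classFiltration_inf hk, Subgroup.inf_relIndex_right, Subgroup.relIndex_comap]
    rfl
  have hmul := Subgroup.relIndex_mul_relIndex ⊥ _ _ bot_le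
    (h.classFiltration_antitone (show 2 * k + 1 ≤ 2 * k + 2 by lia))
  rwa [hrel, Subgroup.relIndex_bot_left, Subgroup.relIndex_bot_left, mul_comm, eq_comm] at hmul

include h

theorem isSquare_of_sub_sq_lt {u : Fˣ} {t : F} (ht : v t = 1)
    (hut : v ((u : F) - t ^ 2) < ρ ^ (2 * e)) : IsSquare u := by
  have h4 := h.four_ne_zero
  have ht0 : t ≠ 0 := v.ne_zero_iff.1 (by simp [ht])
  obtain ⟨y, hy⟩ := h.exists_artinSchreier (((u : F) / t ^ 2 - 1) / 4) (by
    rw [div_sub_one (pow_ne_zero 2 ht0), map_div₀, map_div₀, h.map_four, map_pow, ht, one_pow,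
      div_one]
    exact (div_lt_one (pow_pos h.pos _)).2 hut)
  have hsq : (u : F) = (t * (1 + 2 * y)) ^ 2 := by
    field_simp at hy
    linear_combination -hy
  have hne : t * (1 + 2 * y) ≠ 0 := fun h0 => u.ne_zero (by rw [hsq, h0, zero_pow (by norm_num)])
  exact isSquare_iff_exists_sq _ |>.2 ⟨Units.mk0 _ hne, Units.ext hsq⟩

theorem map_sub_one_div_two_le {s : F} (hs : v (s ^ 2 - 1) ≤ ρ ^ (2 * e)) :
    v ((s - 1) / 2) ≤ 1 := by
  rw [map_div₀, h.map_two, div_le_one (pow_pos h.pos e), ← h.map_two]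
  by_contra! hlt
  rw [show s ^ 2 - 1 = (s - 1) * (s - 1 + 2) by ring, map_mul, h.nonarch.add_eq_left_of_lt hlt,
    mul_comm 2 e, pow_mul, ← h.map_two, sq] at hs
  exact hs.not_gt (mul_lt_mul'' hlt hlt (v.nonneg _) (v.nonneg _))

/-- With `v 4 = ρ ^ (2 e)`, squaring on `U_{2e}` is the Artin–Schreier map on leading coefficients:
`(1 + 2 x)² = 1 + 4 (x² + x)`. -/
theorem isSquare_iff_leadingCoeff_mem [CharP (residueOf v h.nonarch) 2]
    (he : 0 < 2 * e) (u : h.unitFiltration (2 * e)) :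
    IsSquare (u : Fˣ) ↔ h.leadingCoeff he h.map_four u ∈
      (artinSchreier (residueOf v h.nonarch)).toMultiplicative.range := by
  have h2 := h.two_ne_zero
  constructor
  · rintro hsq
    obtain ⟨s, hs⟩ := (isSquare_iff_exists_sq _).1 hsq
    have hus : ((u : Fˣ) : F) = (s : F) ^ 2 := by rw [hs, Units.val_pow_eq_pow_val]
    let x : unitBall v h.nonarch := ⟨((s : F) - 1) / 2, h.map_sub_one_div_two_le (hus ▸ u.2.2)⟩
    refine ⟨.ofAdd (IsLocalRing.residue _ x), Eq.symm ?_⟩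
    change _ = Multiplicative.ofAdd (IsLocalRing.residue _ x ^ 2 + IsLocalRing.residue _ x)
    rw [← map_pow, ← map_add, leadingCoeff_eq_iff, hus]
    have hzero : (s : F) ^ 2 - (1 + 4 * ((x ^ 2 + x : unitBall v h.nonarch) : F)) = 0 := by
      push_cast [x]; field_simp; ring
    rw [hzero, map_zero]
    exact pow_pos h.pos _
  · rintro ⟨a, ha⟩
    obtain ⟨x, hx⟩ := IsLocalRing.residue_surjective a.toAdd
    have hax : h.leadingCoeff he h.map_four u = .ofAdd (IsLocalRing.residue _ (x ^ 2 + x)) := by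
      rw [← ha, map_add, map_pow, hx]
      rfl
    rw [leadingCoeff_eq_iff] at hax
    have h2x : v (2 * x) < 1 := by
      rw [map_mul]
      exact mul_lt_one_of_nonneg_of_lt_one_left (v.nonneg _) h.map_two_lt_one x.2
    refine h.isSquare_of_sub_sq_lt (map_one_add_of_lt_one h.nonarch h2x) ?_
    convert hax using 3
    push_cast; ring

theorem card_classFiltration_two_mul_self :
    Nat.card (h.classFiltration (2 * e)) = 2 := by
  have := h.charP_residue
  have := h.finite_residue
  have he : 0 < 2 * e := by have := h.e_pos; lia
  have hker : (sqClass (F := F)).ker.subgroupOf (h.unitFiltration (2 * e)) =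
      (artinSchreier (residueOf v h.nonarch)).toMultiplicative.range.comap
        (h.leadingCoeff he h.map_four) := by
    ext u
    rw [Subgroup.mem_subgroupOf, MonoidHom.mem_ker, sqClass_eq_one_iff, Subgroup.mem_comap,
      h.isSquare_iff_leadingCoeff_mem]
  rw [classFiltration, ← Subgroup.relIndex_ker, Subgroup.relIndex, hker,
    Subgroup.index_comap_of_surjective _ (h.leadingCoeff_surjective he h.map_four)]
  exact index_range_artinSchreier _

theorem card_classFiltration_even {k : ℕ} (hk : k ≤ e) :
    Nat.card (h.classFiltration (2 * (e - k))) = 2 * q ^ k := by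
  induction k with
  | zero => simpa using h.card_classFiltration_two_mul_self
  | succ k ih =>
    rw [h.classFiltration_two_mul (by lia), h.card_classFiltration_odd (by lia),
      show 2 * (e - (k + 1)) + 2 = 2 * (e - k) by lia, ih (by lia)]
    ring

theorem card_classFiltration_zero :
    Nat.card (h.classFiltration 0) = 2 * q ^ e := by
  simpa using h.card_classFiltration_even le_rfl

theorem card_squareClass : Nat.card (SquareClass F) = 2 * (2 * q ^ e) := by
  rw [← (h.classFiltration 0).card_mul_index, h.index_classFiltration_zero,
    h.card_classFiltration_zero, mul_comm]

theorem finite_squareClass : Finite (SquareClass F) := by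
  have := h.q_pos
  exact Nat.finite_of_card_ne_zero (by rw [h.card_squareClass]; positivity)

end IsDyadic

section FinsumSdiff

theorem finsum_mem_sdiff_add_sdiff {α M : Type*} [Finite α] [AddCommMonoid M] {r s t : Set α}
    (hrs : r ⊆ s) (hst : s ⊆ t) (f : α → M) :
    (∑ᶠ x ∈ s \ r, f x) + ∑ᶠ x ∈ t \ s, f x = ∑ᶠ x ∈ t \ r, f x := by
  rw [← finsum_mem_union (Set.disjoint_left.2 fun x hx hx' => hx'.2 hx.1) (Set.toFinite _)
    (Set.toFinite _), Set.union_comm, Set.sdiff_union_sdiff_cancel hst hrs]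

theorem finsum_mem_subgroup_sdiff_of_const {G : Type*} [Group G] [Finite G] {H K : Subgroup G}
    (hHK : H ≤ K) {f : G → ℝ} {c : ℝ} (hf : ∀ g ∈ K, g ∉ H → f g = c) :
    ∑ᶠ g ∈ (K : Set G) \ H, f g = (Nat.card K - Nat.card H) * c := by
  have hcard := Set.ncard_sdiff_add_ncard_of_subset (s := (H : Set G)) (t := K) hHK
  simp only [← Nat.card_coe_set_eq (H : Set G), ← Nat.card_coe_set_eq (K : Set G),
    SetLike.coe_sort_coe] at hcard
  rw [finsum_mem_congr rfl fun g hg => hf g hg.1 hg.2,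
    finsum_mem_eq_finite_toFinset_sum _ (Set.toFinite _), Finset.sum_const, nsmul_eq_mul,
    ← Set.ncard_eq_toFinset_card _ (Set.toFinite _), ← hcard]
  push_cast
  ring

end FinsumSdiff

namespace IsDyadic

variable {F : Type*} [Field F] {v : AbsoluteValue F ℝ} {ρ : ℝ} {q e : ℕ}

open Classical in
/-- `2e + 1` minus the largest `j ≤ 2e` such that `g` lies in the `j`-th step of the filtration. For
`g` outside the step `2e`, this is the valuation of the discriminant of the ramified quadratic
extension generated by a square root of `g`. If `g` lies in no step at all, `Nat.findGreatest` is
`0`, so that the value is `2e + 1`, as it should be. -/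
noncomputable def discExp (h : IsDyadic v ρ q e) (g : SquareClass F) : ℕ :=
  2 * e + 1 - Nat.findGreatest (g ∈ h.classFiltration ·) (2 * e)

/-- The square classes whose square roots generate ramified extensions. -/
def ramClasses (h : IsDyadic v ρ q e) : Set (SquareClass F) := (h.classFiltration (2 * e) : Set _)ᶜ

variable (h : IsDyadic v ρ q e) {g : SquareClass F}

open Classical in
theorem discExp_of_notMem_zero (hg : g ∉ h.classFiltration 0) : h.discExp g = 2 * e + 1 := by
  have hzero : Nat.findGreatest (g ∈ h.classFiltration ·) (2 * e) = 0 :=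
    Nat.findGreatest_eq_zero_iff.2 fun _ _ _ hn =>
      hg (h.classFiltration_antitone (Nat.zero_le _) hn)
  rw [discExp, hzero, Nat.sub_zero]

open Classical in
theorem discExp_of_mem_of_notMem {k : ℕ} (hk : k < e) (hg : g ∈ h.classFiltration (2 * k + 1))
    (hg' : g ∉ h.classFiltration (2 * k + 2)) : h.discExp g = 2 * (e - k) := by
  have hgreatest : Nat.findGreatest (g ∈ h.classFiltration ·) (2 * e) = 2 * k + 1 :=
    Nat.findGreatest_eq_iff.2 ⟨by lia, fun _ => hg, fun n hn _ hgn =>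
      hg' (h.classFiltration_antitone (by lia) hgn)⟩
  rw [discExp, hgreatest]
  lia

theorem notMem_zero_or_exists_of_mem_ramClasses (hg : g ∈ h.ramClasses) :
    g ∉ h.classFiltration 0 ∨
      ∃ k < e, g ∈ h.classFiltration (2 * k + 1) ∧ g ∉ h.classFiltration (2 * k + 2) := by
  by_contra! hstep
  have hmem : ∀ k ≤ e, g ∈ h.classFiltration (2 * k) := by
    intro k
    induction k with
    | zero => exact fun _ => hstep.1
    | succ k ih =>
      exact fun hk => hstep.2 k (by lia) (h.classFiltration_two_mul (k := k) (by lia) ▸ ih (by lia))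
  exact hg (hmem e le_rfl)

theorem exists_eisenstein_of_notMem_zero (hg : g ∉ h.classFiltration 0) :
    ∃ (a b : F) (u : Fˣ), v a < 1 ∧ v b = ρ ∧ u = a ^ 2 - 4 * b ∧ sqClass u = g ∧
      v u = ρ ^ (2 * e + 1) := by
  obtain ⟨u, rfl⟩ := sqClass_surjective g
  obtain ⟨n, hn⟩ := h.exists_zpow u u.ne_zero
  obtain ⟨m, rfl⟩ : Odd n := by
    refine Int.not_even_iff_odd.1 fun ⟨m, hm⟩ => hg (h.sqClass_mem_classFiltration_zero.2 ⟨m, ?_⟩)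
    rw [hn, hm, two_mul]
  obtain ⟨s, hs⟩ := h.exists_unit_zpow (-m)
  have hb : v (-(u * s ^ 2) : F) = ρ := by
    rw [v.map_neg, map_mul, map_pow, hn, hs, ← zpow_natCast, ← zpow_mul, ← zpow_add₀ h.pos.ne']
    convert zpow_one ρ using 2
    push_cast
    ring
  let two : Fˣ := Units.mk0 2 h.two_ne_zero
  have hdiscr : ((u * (two * s) ^ 2 : Fˣ) : F) = 0 ^ 2 - 4 * -(u * s ^ 2) := by
    push_cast [two, Units.val_mk0]
    ring
  refine ⟨0, _, u * (two * s) ^ 2, by simp, hb, hdiscr, sqClass_eq_iff.2 ⟨_, rfl⟩, ?_⟩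
  rw [hdiscr, zero_pow _root_.two_ne_zero, zero_sub, v.map_neg, map_mul, hb, h.map_four, pow_succ]

theorem exists_eisenstein_of_mem_of_notMem {k : ℕ} (hk : k < e)
    (hg : g ∈ h.classFiltration (2 * k + 1)) (hg' : g ∉ h.classFiltration (2 * k + 2)) :
    ∃ (a b : F) (u : Fˣ), v a < 1 ∧ v b = ρ ∧ u = a ^ 2 - 4 * b ∧ sqClass u = g ∧
      v u = ρ ^ (2 * (e - k)) := by
  obtain ⟨u, hu, rfl⟩ := hg
  have hsub : v ((u : F) - 1) = ρ ^ (2 * k + 1) :=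
    le_antisymm hu.2 (not_lt.1 fun hlt =>
      hg' (Subgroup.mem_map_of_mem sqClass ⟨hu.1, h.le_pow_of_lt hlt⟩))
  obtain ⟨s, hs⟩ := h.exists_unit_zpow (-k)
  have ha : v (2 * s : F) = ρ ^ (e - k) := by
    rw [map_mul, h.map_two, hs, zpow_neg, zpow_natCast, pow_sub₀ _ h.pos.ne' hk.le]
  have hb : v (-((u - 1) * s ^ 2) : F) = ρ := by
    rw [v.map_neg, map_mul, map_pow, hsub, hs, zpow_neg, zpow_natCast]
    field_simp [h.pos.ne']
    ring
  let two : Fˣ := Units.mk0 2 h.two_ne_zero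
  have hdiscr : ((u * (two * s) ^ 2 : Fˣ) : F) = (2 * s) ^ 2 - 4 * -((u - 1) * s ^ 2) := by
    push_cast [two, Units.val_mk0]
    ring
  refine ⟨_, _, u * (two * s) ^ 2, ha ▸ h.pow_lt_one (by lia), hb, hdiscr,
    sqClass_eq_iff.2 ⟨_, rfl⟩, ?_⟩
  have hval : v ((u * (two * s) ^ 2 : Fˣ) : F) = v u * v (2 * s : F) ^ 2 := by
    push_cast [two, Units.val_mk0]
    rw [map_mul, map_pow]
  rw [hval, hu.1, ha, one_mul, ← pow_mul, mul_comm]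

theorem exists_eisenstein_of_mem_ramClasses (hg : g ∈ h.ramClasses) :
    ∃ (a b : F) (u : Fˣ), v a < 1 ∧ v b = ρ ∧ u = a ^ 2 - 4 * b ∧ sqClass u = g ∧
      v u = ρ ^ h.discExp g := by
  rcases h.notMem_zero_or_exists_of_mem_ramClasses hg with hzero | ⟨k, hk, hmem, hnot⟩
  · rw [h.discExp_of_notMem_zero hzero]
    exact h.exists_eisenstein_of_notMem_zero hzero
  · rw [h.discExp_of_mem_of_notMem hk hmem hnot]
    exact h.exists_eisenstein_of_mem_of_notMem hk hmem hnot

theorem sqClass_mem_ramClasses_of_eisenstein_of_lt {a b : F} (ha : v a < ρ ^ e) (hb : v b = ρ)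
    {u : Fˣ} (hu : (u : F) = a ^ 2 - 4 * b) : sqClass u ∈ h.ramClasses := by
  have h4b : v (-(4 * b)) = ρ ^ (2 * e + 1) := by
    rw [v.map_neg, map_mul, h.map_four, hb, pow_succ]
  have ha2 : v (a ^ 2) ≤ ρ ^ (2 * e + 2) := by
    rw [map_pow, show 2 * e + 2 = (e + 1) * 2 by ring, pow_mul]
    exact pow_le_pow_left₀ (v.nonneg a) (h.le_pow_of_lt ha) 2
  have hvu : v u = ρ ^ (2 * e + 1) := by
    rw [hu, sub_eq_add_neg, h.nonarch.add_eq_right_of_lt, h4b]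
    exact h4b ▸ ha2.trans_lt (h.pow_lt_pow_iff.2 (Nat.lt_succ_self _))
  intro hmem
  obtain ⟨m, hm⟩ := h.sqClass_mem_classFiltration_zero.1
    (h.classFiltration_antitone (Nat.zero_le _) hmem)
  rw [hvu, ← zpow_natCast] at hm
  have := h.zpow_inj hm
  lia

theorem sqClass_mem_ramClasses_of_eisenstein_of_ge {a b : F} (ha : v a < 1) (hae : ρ ^ e ≤ v a)
    (hb : v b = ρ) {u : Fˣ} (hu : (u : F) = a ^ 2 - 4 * b) : sqClass u ∈ h.ramClasses := by
  have ha0 : a ≠ 0 := by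
    rintro rfl
    exact (pow_pos h.pos e).not_ge (by simpa using hae)
  obtain ⟨n, hn⟩ := h.exists_zpow a ha0
  rw [hn, ← zpow_natCast, h.zpow_le_zpow_iff] at hae
  rw [hn, ← zpow_zero ρ, h.zpow_lt_zpow_iff] at ha
  lift n to ℕ using ha.le with i
  rw [zpow_natCast] at hn
  have hquot : v (-(4 * b) / a ^ 2) = ρ ^ (2 * (e - i) + 1) := by
    rw [map_div₀, v.map_neg, map_mul, h.map_four, hb, ← pow_succ, map_pow, hn, ← pow_mul,
      div_eq_mul_inv, ← pow_sub₀ _ h.pos.ne' (by lia)]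
    congr 1
    lia
  obtain ⟨w, -, hw⟩ := h.exists_mem_unitFiltration_eq_one_add (Nat.succ_pos _) hquot.le
  have hclass : sqClass u = sqClass w := by
    refine sqClass_eq_iff.2 ⟨Units.mk0 a ha0, Units.ext ?_⟩
    rw [Units.val_mul, Units.val_pow_eq_pow_val, Units.val_mk0, hw, hu]
    field_simp
    ring
  rw [hclass]
  intro hmem
  refine h.sqClass_notMem_classFiltration (u := w) (k := e - i) (by lia) ?_
    (h.classFiltration_antitone (by lia) hmem)
  rw [hw, add_sub_cancel_left, hquot]

theorem sqClass_mem_ramClasses_of_eisenstein {a b : F} (ha : v a < 1) (hb : v b = ρ) {u : Fˣ}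
    (hu : (u : F) = a ^ 2 - 4 * b) : sqClass u ∈ h.ramClasses :=
  (lt_or_ge (v a) (ρ ^ e)).elim (fun hlt => h.sqClass_mem_ramClasses_of_eisenstein_of_lt hlt hb hu)
    fun hge => h.sqClass_mem_ramClasses_of_eisenstein_of_ge ha hge hb hu

theorem sum_discExp_classFiltration_sdiff (φ : ℕ → ℝ) {k : ℕ} (hk : k ≤ e) :
    ∑ᶠ g ∈ (h.classFiltration (2 * (e - k)) : Set (SquareClass F)) \ h.classFiltration (2 * e),
      φ (h.discExp g) = ∑ i ∈ Finset.range k, 2 * (q - 1) * q ^ i * φ (2 * (i + 1)) := by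
  have := h.finite_squareClass
  induction k with
  | zero => simp
  | succ k ih =>
    have hsucc : 2 * (e - (k + 1)) + 2 = 2 * (e - k) := by lia
    have hlayer : ∀ g ∈ h.classFiltration (2 * (e - (k + 1))),
        g ∉ h.classFiltration (2 * (e - k)) → φ (h.discExp g) = φ (2 * (k + 1)) := by
      intro g hg hg'
      rw [h.discExp_of_mem_of_notMem (k := e - (k + 1)) (by lia)
        (h.classFiltration_two_mul (k := e - (k + 1)) (by lia) ▸ hg) (hsucc ▸ hg')]
      congr 2
      lia
    rw [← finsum_mem_sdiff_add_sdiff (h.classFiltration_antitone (by lia))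
        (h.classFiltration_antitone (by lia)) (s := h.classFiltration (2 * (e - k))),
      ih (by lia), Finset.sum_range_succ,
      finsum_mem_subgroup_sdiff_of_const (h.classFiltration_antitone (by lia)) hlayer,
      h.card_classFiltration_even hk, h.card_classFiltration_even (by lia)]
    push_cast
    ring

theorem sum_discExp_ramClasses (φ : ℕ → ℝ) : ∑ᶠ g ∈ h.ramClasses, φ (h.discExp g) =
    2 * q ^ e * φ (2 * e + 1) + ∑ i ∈ Finset.range e, 2 * (q - 1) * q ^ i * φ (2 * (i + 1)) := by
  have := h.finite_squareClass
  rw [ramClasses, Set.compl_eq_univ_sdiff, ← Subgroup.coe_top, ← finsum_mem_sdiff_add_sdiff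
      (h.classFiltration_antitone (Nat.zero_le _)) (SetLike.coe_subset_coe.2 le_top),
    finsum_mem_subgroup_sdiff_of_const le_top fun g _ hg => by rw [h.discExp_of_notMem_zero hg],
    Subgroup.card_top, h.card_squareClass, h.card_classFiltration_zero, add_comm,
    ← h.sum_discExp_classFiltration_sdiff φ le_rfl, Nat.sub_self, mul_zero]
  push_cast
  ring

end IsDyadic

/-! ### Ramified quadratic extensions -/

section Quadratic

variable {F Ω : Type*} [Field F] [Field Ω] [Algebra F Ω]

/-- The restriction of an absolute value to a subfield. -/
noncomputable def restrictAbs (F : Type*) [Field F] [Algebra F Ω] (N : AbsoluteValue Ω ℝ) :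
    AbsoluteValue F ℝ := N.comp (algebraMap F Ω).injective

theorem restrictAbs_apply (N : AbsoluteValue Ω ℝ) (x : F) :
    restrictAbs F N x = N (algebraMap F Ω x) := rfl

theorem isNonarchimedean_restrictAbs {N : AbsoluteValue Ω ℝ} (hN : IsNonarchimedean N) :
    IsNonarchimedean (restrictAbs F N) := fun x y => by
  simpa only [restrictAbs_apply, map_add] using hN (algebraMap F Ω x) (algebraMap F Ω y)

theorem exists_algEquiv_eq_neg_sub [IsGalois F Ω] {x : Ω} {a b : F}
    (hx : x ^ 2 + algebraMap F Ω a * x + algebraMap F Ω b = 0)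
    (hxF : x ∉ Set.range (algebraMap F Ω)) : ∃ σ : Ω ≃ₐ[F] Ω, σ x = -algebraMap F Ω a - x := by
  contrapose! hxF
  refine (InfiniteGalois.mem_range_algebraMap_iff_fixed x).2 fun σ => ?_
  have hσx := congrArg σ hx
  simp only [map_add, map_mul, map_pow, AlgEquiv.commutes, map_zero] at hσx
  have hprod : (σ x - x) * (σ x - (-algebraMap F Ω a - x)) = 0 := by linear_combination hσx - hx
  exact sub_eq_zero.1 ((mul_eq_zero.1 hprod).resolve_right (sub_ne_zero.2 (hxF σ)))

theorem exists_artinSchreier_root [IsGalois F Ω] [IsAlgClosed Ω] {N : AbsoluteValue Ω ℝ}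
    (hN : IsNonarchimedean N) (hinv : ∀ (σ : Ω ≃ₐ[F] Ω) (x : Ω), N (σ x) = N x) (c : F)
    (hc : restrictAbs F N c < 1) : ∃ y : F, y ^ 2 + y = c := by
  have hdeg : (Polynomial.X ^ 2 + Polynomial.X -
      Polynomial.C (algebraMap F Ω c)).degree = 2 := by compute_degree!
  obtain ⟨y, hy⟩ := IsAlgClosed.exists_root _ (hdeg ▸ two_ne_zero)
  replace hy : y ^ 2 + y - algebraMap F Ω c = 0 := by simpa using hy
  by_cases hyF : y ∈ Set.range (algebraMap F Ω)
  · obtain ⟨a, rfl⟩ := hyF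
    refine ⟨a, (algebraMap F Ω).injective ?_⟩
    rw [map_add, map_pow]
    linear_combination hy
  -- Otherwise the roots `y` and `-1 - y` are conjugate, so both have the same absolute value,
  -- which is less than `1` since their product is `-c`; but their sum is `-1`.
  exfalso
  obtain ⟨σ, hσ⟩ := exists_algEquiv_eq_neg_sub (x := y) (a := (1 : F)) (b := -c)
    (by rw [map_one, map_neg]; linear_combination hy) hyF
  rw [map_one] at hσ
  have hconj : N (-1 - y) = N y := by rw [← hσ, hinv]
  have hprod : N y * N y < 1 := by
    nth_rewrite 2 [← hconj]
    rw [← map_mul, show y * (-1 - y) = -algebraMap F Ω c by linear_combination -hy, N.map_neg]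
    exact hc
  have hsum := hN (-1 - y) y
  rw [sub_add_cancel, N.map_neg, map_one, hconj, max_self] at hsum
  nlinarith

theorem finrank_adjoin_eq_two {x : Ω} {a b : F}
    (hx : x ^ 2 + algebraMap F Ω a * x + algebraMap F Ω b = 0)
    (hxF : x ∉ Set.range (algebraMap F Ω)) :
    Module.finrank F (IntermediateField.adjoin F {x}) = 2 := by
  set p : Polynomial F :=
    Polynomial.X ^ 2 + Polynomial.C a * Polynomial.X + Polynomial.C b with hp
  have hdeg : p.natDegree = 2 := by rw [hp]; compute_degree!
  have hmonic : p.Monic := by rw [hp]; monicity!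
  have hroot : Polynomial.aeval x p = 0 := by simpa [hp] using hx
  have hint : IsIntegral F x := ⟨p, hmonic, hroot⟩
  rw [IntermediateField.adjoin.finrank hint]
  refine le_antisymm ?_ ((minpoly.two_le_natDegree_iff hint).2 hxF)
  exact hdeg ▸ Polynomial.natDegree_le_of_dvd (minpoly.dvd F x hroot) hmonic.ne_zero

theorem adjoin_eq_of_finrank_eq_two {E : IntermediateField F Ω} (hE : Module.finrank F E = 2)
    {x : Ω} (hx : x ∈ E) (hxF : x ∉ Set.range (algebraMap F Ω)) :
    IntermediateField.adjoin F {x} = E := by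
  have hfin : FiniteDimensional F E := Module.finite_of_finrank_pos (by lia)
  have hint : IsIntegral F x := (IsIntegral.of_finite F (⟨x, hx⟩ : E)).map E.val
  refine IntermediateField.eq_of_le_of_finrank_le
    (IntermediateField.adjoin_le_iff.2 (Set.singleton_subset_iff.2 hx)) ?_
  rw [hE, IntermediateField.adjoin.finrank hint]
  exact (minpoly.two_le_natDegree_iff hint).2 hxF

theorem exists_quadratic_of_finrank_eq_two {E : IntermediateField F Ω}
    (hE : Module.finrank F E = 2) {x : Ω} (hx : x ∈ E) (hxF : x ∉ Set.range (algebraMap F Ω)) :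
    ∃ a b : F, x ^ 2 + algebraMap F Ω a * x + algebraMap F Ω b = 0 := by
  have hfin : FiniteDimensional F E := Module.finite_of_finrank_pos (by lia)
  have hint : IsIntegral F x := (IsIntegral.of_finite F (⟨x, hx⟩ : E)).map E.val
  have hdeg : (minpoly F x).natDegree = 2 := by
    rw [← IntermediateField.adjoin.finrank hint, adjoin_eq_of_finrank_eq_two hE hx hxF, hE]
  have hlead : (minpoly F x).coeff 2 = 1 := hdeg ▸ minpoly.monic hint
  have hroot := minpoly.aeval F x
  rw [Polynomial.aeval_eq_sum_range, hdeg] at hroot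
  simp only [Finset.sum_range_succ, Finset.sum_range_zero, hlead, Algebra.smul_def, pow_zero,
    pow_one, map_one] at hroot
  exact ⟨(minpoly F x).coeff 1, (minpoly F x).coeff 0, by linear_combination hroot⟩

variable (Ω) in
/-- The extension of `F` generated by the square roots of a square class. -/
def sqrtField (g : SquareClass F) : IntermediateField F Ω :=
  IntermediateField.adjoin F {x : Ω | ∃ u : Fˣ, sqClass u = g ∧ x ^ 2 = algebraMap F Ω u}

theorem sqrtField_eq {r : Ω} {u : Fˣ} (hr : r ^ 2 = algebraMap F Ω u) :
    sqrtField Ω (sqClass u) = IntermediateField.adjoin F {r} := by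
  apply le_antisymm
  · rw [sqrtField, IntermediateField.adjoin_le_iff]
    rintro x ⟨w, hw, hx⟩
    obtain ⟨s, rfl⟩ := sqClass_eq_iff.1 hw
    have hmem : r * algebraMap F Ω s ∈ IntermediateField.adjoin F {r} :=
      mul_mem (IntermediateField.mem_adjoin_simple_self F r) (IntermediateField.algebraMap_mem _ _)
    have hsq : x ^ 2 = (r * algebraMap F Ω s) ^ 2 := by
      rw [hx, mul_pow, hr, Units.val_mul, Units.val_pow_eq_pow_val, map_mul, map_pow]
    rcases sq_eq_sq_iff_eq_or_eq_neg.1 hsq with rfl | rfl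
    exacts [hmem, neg_mem hmem]
  · rw [IntermediateField.adjoin_le_iff, Set.singleton_subset_iff]
    exact IntermediateField.subset_adjoin _ _ ⟨u, rfl, hr⟩

theorem exists_sq_eq_algebraMap [IsAlgClosed Ω] (u : Fˣ) : ∃ r : Ω, r ^ 2 = algebraMap F Ω u :=
  IsAlgClosed.exists_pow_nat_eq _ two_pos

theorem adjoin_two_mul_add (h2 : (2 : Ω) ≠ 0) (w : Ω) (a : F) :
    IntermediateField.adjoin F {2 * w + algebraMap F Ω a} = IntermediateField.adjoin F {w} := by
  have two_mem (E : IntermediateField F Ω) : (2 : Ω) ∈ E := by exact_mod_cast natCast_mem E 2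
  refine le_antisymm ?_ ?_ <;> rw [IntermediateField.adjoin_le_iff, Set.singleton_subset_iff]
  · exact add_mem (mul_mem (two_mem _) (IntermediateField.mem_adjoin_simple_self F w))
      (IntermediateField.algebraMap_mem _ a)
  · have hw : (2 * w + algebraMap F Ω a - algebraMap F Ω a) / 2 = w := by field_simp; ring
    have hmem := div_mem (sub_mem (IntermediateField.mem_adjoin_simple_self F
      (2 * w + algebraMap F Ω a)) (IntermediateField.algebraMap_mem _ a)) (two_mem _)
    rwa [hw] at hmem

theorem sqrtField_discr_eq_adjoin (h2 : (2 : Ω) ≠ 0) {w : Ω} {a b : F}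
    (hw : w ^ 2 + algebraMap F Ω a * w + algebraMap F Ω b = 0) {u : Fˣ}
    (hu : (u : F) = a ^ 2 - 4 * b) :
    sqrtField Ω (sqClass u) = IntermediateField.adjoin F {w} := by
  have hr : (2 * w + algebraMap F Ω a) ^ 2 = algebraMap F Ω u := by
    rw [hu, map_sub, map_mul, map_pow, map_ofNat]
    linear_combination 4 * hw
  rw [sqrtField_eq hr, adjoin_two_mul_add h2]

theorem algEquiv_eq_or_eq_neg_of_sq {r : Ω} {a : F} (hr : r ^ 2 = algebraMap F Ω a)
    (σ : Ω ≃ₐ[F] Ω) : σ r = r ∨ σ r = -r := by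
  rw [← sq_eq_sq_iff_eq_or_eq_neg, ← map_pow, hr, AlgEquiv.commutes]

theorem algEquiv_eq_self_of_mem_adjoin {r y : Ω} {σ : Ω ≃ₐ[F] Ω} (hσ : σ r = r)
    (hy : y ∈ IntermediateField.adjoin F {r}) : σ y = y :=
  (IntermediateField.forall_mem_adjoin_smul_eq_self_iff F σ).2 (by simpa using hσ) y hy

theorem mul_mem_range_of_adjoin_eq [IsGalois F Ω] {r s : Ω} {a b : F}
    (hr : r ^ 2 = algebraMap F Ω a) (hs : s ^ 2 = algebraMap F Ω b)
    (hrs : IntermediateField.adjoin F {r} = IntermediateField.adjoin F {s}) :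
    r * s ∈ Set.range (algebraMap F Ω) := by
  have hr_mem : r ∈ IntermediateField.adjoin F {s} :=
    hrs ▸ IntermediateField.mem_adjoin_simple_self F r
  have hs_mem : s ∈ IntermediateField.adjoin F {r} :=
    hrs ▸ IntermediateField.mem_adjoin_simple_self F s
  refine (InfiniteGalois.mem_range_algebraMap_iff_fixed _).2 fun σ => ?_
  rw [map_mul]
  rcases algEquiv_eq_or_eq_neg_of_sq hr σ with hσr | hσr
  · rw [hσr, algEquiv_eq_self_of_mem_adjoin hσr hs_mem]
  · rcases algEquiv_eq_or_eq_neg_of_sq hs σ with hσs | hσs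
    · rw [hσs, algEquiv_eq_self_of_mem_adjoin hσs hr_mem]
    · rw [hσr, hσs, neg_mul_neg]

theorem sqrtField_injective [IsGalois F Ω] [IsAlgClosed Ω] :
    Function.Injective (sqrtField (F := F) Ω) := by
  intro g g' hgg
  obtain ⟨u, rfl⟩ := sqClass_surjective g
  obtain ⟨w, rfl⟩ := sqClass_surjective g'
  obtain ⟨r, hr⟩ := exists_sq_eq_algebraMap (Ω := Ω) u
  obtain ⟨s, hs⟩ := exists_sq_eq_algebraMap (Ω := Ω) w
  rw [sqrtField_eq hr, sqrtField_eq hs] at hgg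
  obtain ⟨c, hc⟩ := mul_mem_range_of_adjoin_eq hr hs hgg
  have hc2 : c ^ 2 = u * w := (algebraMap F Ω).injective <| by
    rw [map_pow, map_mul, hc, mul_pow, hr, hs]
  have hc0 : c ≠ 0 := pow_ne_zero_iff two_ne_zero |>.1 (hc2 ▸ mul_ne_zero u.ne_zero w.ne_zero)
  refine sqClass_eq_iff.2 ⟨Units.mk0 c hc0 * w⁻¹, Units.ext ?_⟩
  have := w.ne_zero
  push_cast
  rw [Units.val_mk0, mul_pow, hc2]
  field_simp

end Quadratic

section Quadratic

variable {F Ω : Type*} [Field F] [Field Ω] [Algebra F Ω]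

/-- A field `F` inside `Ω` on which the absolute value `N` of `Ω` is dyadic, with `N` invariant
under the automorphisms of `Ω` over `F`. -/
structure IsDyadicBase (F : Type*) [Field F] [Algebra F Ω] (N : AbsoluteValue Ω ℝ) (ρ : ℝ)
    (q e : ℕ) : Prop where
  dyadic : IsDyadic (restrictAbs F N) ρ q e
  nonarch : IsNonarchimedean N
  map_algEquiv : ∀ (σ : Ω ≃ₐ[F] Ω) (x : Ω), N (σ x) = N x

/-- The totally ramified quadratic extensions of `F` inside `Ω`, when `ρ` is the absolute value of
a uniformiser of `F`: those containing an element of half the valuation of a uniformiser. -/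
def ramQuadratics (F : Type*) [Field F] [Algebra F Ω] (N : AbsoluteValue Ω ℝ) (ρ : ℝ) :
    Set (IntermediateField F Ω) :=
  {E | Module.finrank F E = 2 ∧ ∃ ϖ ∈ E, N ϖ ^ 2 = ρ}

/-- `E` contains a root of an Eisenstein polynomial of degree `2` whose discriminant has
valuation `d`. -/
def HasDisc (N : AbsoluteValue Ω ℝ) (ρ : ℝ) (E : IntermediateField F Ω) (d : ℕ) : Prop :=
  ∃ ϖ ∈ E, N ϖ ^ 2 = ρ ∧ ∃ a b : F, ϖ ^ 2 + algebraMap F Ω a * ϖ + algebraMap F Ω b = 0 ∧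
    restrictAbs F N (a ^ 2 - 4 * b) = ρ ^ d

namespace IsDyadicBase

variable {N : AbsoluteValue Ω ℝ} {ρ : ℝ} {q e : ℕ} (H : IsDyadicBase F N ρ q e)
include H

theorem notMem_range_of_sq {x : Ω} (hx : N x ^ 2 = ρ) : x ∉ Set.range (algebraMap F Ω) := by
  rintro ⟨c, rfl⟩
  have hc : c ≠ 0 := by
    rintro rfl
    simp only [map_zero, ne_eq, OfNat.ofNat_ne_zero, not_false_eq_true, zero_pow] at hx
    exact H.dyadic.pos.ne hx
  obtain ⟨n, hn⟩ := H.dyadic.exists_zpow c hc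
  rw [← restrictAbs_apply, hn, ← zpow_natCast, ← zpow_mul] at hx
  have := H.dyadic.zpow_inj (hx.trans (zpow_one ρ).symm)
  lia

theorem sq_eq_of_eisenstein {x : Ω} {a b : F}
    (hx : x ^ 2 + algebraMap F Ω a * x + algebraMap F Ω b = 0)
    (ha : restrictAbs F N a < 1) (hb : restrictAbs F N b = ρ) : N x ^ 2 = ρ := by
  have haρ : restrictAbs F N a ≤ ρ := by
    simpa using H.dyadic.le_pow_of_lt (j := 0) (by simpa using ha)
  rw [restrictAbs_apply] at haρ hb
  have hx2 : x ^ 2 = -(algebraMap F Ω a * x) + -algebraMap F Ω b := by linear_combination hx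
  have hax : N (-(algebraMap F Ω a * x)) ≤ ρ * N x := by
    rw [N.map_neg, map_mul]
    exact mul_le_mul_of_nonneg_right haρ (N.nonneg x)
  have hxlt : N x < 1 := by
    by_contra! hge
    have hmax := H.nonarch (-(algebraMap F Ω a * x)) (-algebraMap F Ω b)
    rw [← hx2, map_pow, N.map_neg (algebraMap F Ω b), hb] at hmax
    rcases le_max_iff.1 hmax with hle | hle
    · nlinarith [hle.trans hax, H.dyadic.lt_one]
    · nlinarith [H.dyadic.lt_one]
  have hlt : N (-(algebraMap F Ω a * x)) < N (-algebraMap F Ω b) := by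
    rw [N.map_neg (algebraMap F Ω b), hb]
    exact hax.trans_lt (mul_lt_of_lt_one_right H.dyadic.pos hxlt)
  rw [← map_pow, hx2, H.nonarch.add_eq_right_of_lt hlt, N.map_neg, hb]

theorem two_ne_zero : (2 : Ω) ≠ 0 := by
  rw [← map_ofNat (algebraMap F Ω) 2]
  exact (map_ne_zero _).2 H.dyadic.two_ne_zero

theorem mem_ramQuadratics_and_hasDisc_of_eisenstein [IsAlgClosed Ω] {a b : F}
    (ha : restrictAbs F N a < 1) (hb : restrictAbs F N b = ρ) {u : Fˣ}
    (hu : (u : F) = a ^ 2 - 4 * b) {d : ℕ} (hd : restrictAbs F N u = ρ ^ d) :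
    sqrtField Ω (sqClass u) ∈ ramQuadratics F N ρ ∧ HasDisc N ρ (sqrtField Ω (sqClass u)) d := by
  have h2 := H.two_ne_zero
  obtain ⟨r, hr⟩ := exists_sq_eq_algebraMap (Ω := Ω) u
  have hroot : ((r - algebraMap F Ω a) / 2) ^ 2 +
      algebraMap F Ω a * ((r - algebraMap F Ω a) / 2) + algebraMap F Ω b = 0 := by
    rw [hu, map_sub, map_mul, map_pow, map_ofNat] at hr
    field_simp
    linear_combination hr
  generalize (r - algebraMap F Ω a) / 2 = w at hroot
  have hNw := H.sq_eq_of_eisenstein hroot ha hb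
  have hw : w ∈ sqrtField Ω (sqClass u) :=
    sqrtField_discr_eq_adjoin h2 hroot hu ▸ IntermediateField.mem_adjoin_simple_self F w
  refine ⟨⟨?_, w, hw, hNw⟩, w, hw, hNw, a, b, hroot, hu ▸ hd⟩
  rw [sqrtField_discr_eq_adjoin h2 hroot hu]
  exact finrank_adjoin_eq_two hroot (H.notMem_range_of_sq hNw)

theorem mem_ramQuadratics_and_hasDisc [IsAlgClosed Ω] {g : SquareClass F}
    (hg : g ∈ H.dyadic.ramClasses) :
    sqrtField Ω g ∈ ramQuadratics F N ρ ∧ HasDisc N ρ (sqrtField Ω g) (H.dyadic.discExp g) := by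
  obtain ⟨a, b, u, ha, hb, hu, rfl, hd⟩ := H.dyadic.exists_eisenstein_of_mem_ramClasses hg
  exact H.mem_ramQuadratics_and_hasDisc_of_eisenstein ha hb hu hd

theorem eisenstein_of_sq [IsGalois F Ω] {w : Ω} (hNw : N w ^ 2 = ρ) {a b : F}
    (hw : w ^ 2 + algebraMap F Ω a * w + algebraMap F Ω b = 0) :
    restrictAbs F N a < 1 ∧ restrictAbs F N b = ρ := by
  obtain ⟨σ, hσ⟩ := exists_algEquiv_eq_neg_sub hw (H.notMem_range_of_sq hNw)
  have hsum : algebraMap F Ω a = -w - σ w := by rw [hσ]; ring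
  have hprod : algebraMap F Ω b = w * σ w := by rw [hσ]; linear_combination hw
  have hNw1 : N w < 1 := by
    by_contra! hge
    nlinarith [H.dyadic.lt_one]
  simp only [restrictAbs_apply]
  constructor
  · rw [hsum]
    refine (map_sub_le_max H.nonarch _ _).trans_lt (max_lt ?_ ?_)
    · rwa [N.map_neg]
    · rwa [H.map_algEquiv]
  · rw [hprod, map_mul, H.map_algEquiv, ← hNw, pow_two]

theorem exists_sqrtField_eq [IsGalois F Ω] {E : IntermediateField F Ω}
    (hE : E ∈ ramQuadratics F N ρ) : ∃ g ∈ H.dyadic.ramClasses, sqrtField Ω g = E := by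
  obtain ⟨hfin, w, hwE, hNw⟩ := hE
  have h2 := H.two_ne_zero
  have hwF := H.notMem_range_of_sq hNw
  obtain ⟨a, b, hroot⟩ := exists_quadratic_of_finrank_eq_two hfin hwE hwF
  obtain ⟨ha, hb⟩ := H.eisenstein_of_sq hNw hroot
  have hD0 : a ^ 2 - 4 * b ≠ 0 := by
    intro hD
    have hsq : (2 * w + algebraMap F Ω a) ^ 2 = algebraMap F Ω (a ^ 2 - 4 * b) := by
      rw [map_sub, map_mul, map_pow, map_ofNat]
      linear_combination 4 * hroot
    rw [hD, map_zero, sq_eq_zero_iff] at hsq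
    refine hwF ⟨-a / 2, ?_⟩
    rw [map_div₀, map_neg, map_ofNat]
    field_simp
    linear_combination -hsq
  refine ⟨_, H.dyadic.sqClass_mem_ramClasses_of_eisenstein ha hb (Units.val_mk0 hD0), ?_⟩
  rw [sqrtField_discr_eq_adjoin h2 hroot (Units.val_mk0 hD0),
    adjoin_eq_of_finrank_eq_two hfin hwE hwF]

variable [IsGalois F Ω] [IsAlgClosed Ω]

theorem image_sqrtField_ramClasses : sqrtField Ω '' H.dyadic.ramClasses = ramQuadratics F N ρ := by
  ext E
  constructor
  · rintro ⟨g, hg, rfl⟩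
    exact (H.mem_ramQuadratics_and_hasDisc hg).1
  · exact H.exists_sqrtField_eq

theorem finite_ramQuadratics : (ramQuadratics F N ρ).Finite := by
  have := H.dyadic.finite_squareClass
  exact H.image_sqrtField_ramClasses ▸ Set.toFinite _

theorem exists_disc_and_sum_ramQuadratics : ∃ δ : IntermediateField F Ω → ℕ,
    (∀ E ∈ ramQuadratics F N ρ, HasDisc N ρ E (δ E)) ∧
    ∀ φ : ℕ → ℝ, ∑ᶠ E ∈ ramQuadratics F N ρ, φ (δ E) = 2 * q ^ e * φ (2 * e + 1) +
      ∑ i ∈ Finset.range e, 2 * (q - 1) * q ^ i * φ (2 * (i + 1)) := by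
  have hinj := sqrtField_injective (F := F) (Ω := Ω)
  have hleft := Function.leftInverse_invFun hinj
  rw [← H.image_sqrtField_ramClasses]
  refine ⟨fun E => H.dyadic.discExp (Function.invFun (sqrtField Ω) E), ?_, fun φ => ?_⟩
  · rintro _ ⟨g, hg, rfl⟩
    simp only [hleft g]
    exact (H.mem_ramQuadratics_and_hasDisc hg).2
  · rw [finsum_mem_image hinj.injOn]
    simp only [hleft _]
    exact H.dyadic.sum_discExp_ramClasses φ

end IsDyadicBase

end Quadratic

section Residue

variable {F E : Type*} [Field F] [Field E] [Algebra F E] {v : AbsoluteValue F ℝ}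
  {w : AbsoluteValue E ℝ}

theorem nonempty_residueOf_ringEquiv {hv : IsNonarchimedean v} {hw : IsNonarchimedean w}
    (hvw : ∀ x, w (algebraMap F E x) = v x)
    (happrox : ∀ y, w y ≤ 1 → ∃ x, v x ≤ 1 ∧ w (algebraMap F E x - y) < 1) :
    Nonempty (residueOf v hv ≃+* residueOf w hw) := by
  let f : unitBall v hv →+* unitBall w hw :=
    (algebraMap F E).restrict _ _ fun x hx => (hvw x).trans_le hx
  let g : unitBall v hv →+* residueOf w hw := (IsLocalRing.residue _).comp f
  have hg : Function.Surjective g := by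
    intro y
    obtain ⟨⟨y, hy⟩, rfl⟩ := IsLocalRing.residue_surjective y
    obtain ⟨x, hx, hxy⟩ := happrox y hy
    exact ⟨⟨x, hx⟩, (residue_unitBall_eq_iff _ _).2 hxy⟩
  have hker : IsLocalRing.maximalIdeal (unitBall v hv) = RingHom.ker g := by
    ext x
    rw [RingHom.mem_ker, RingHom.comp_apply, IsLocalRing.residue_eq_zero_iff,
      mem_maximalIdeal_unitBall, mem_maximalIdeal_unitBall, ← hvw]
    rfl
  exact ⟨(Ideal.quotEquivOfEq hker).trans (RingHom.quotientKerEquivOfSurjective hg)⟩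

end Residue

section Quadratic

variable {F Ω : Type*} [Field F] [Field Ω] [Algebra F Ω] {E : IntermediateField F Ω}

theorem linearIndependent_pair {w : E} (hwF : (w : Ω) ∉ Set.range (algebraMap F Ω)) :
    LinearIndependent F ![1, w] := by
  refine (LinearIndependent.pair_iff' one_ne_zero).2 fun a haw => hwF ⟨a, ?_⟩
  rw [← haw, Algebra.smul_def, mul_one]
  rfl

/-- The basis `1, w` of a quadratic extension. -/
noncomputable def pairBasis (hE : Module.finrank F E = 2) {w : E}
    (hwF : (w : Ω) ∉ Set.range (algebraMap F Ω)) : Module.Basis (Fin 2) F E :=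
  basisOfLinearIndependentOfCardEqFinrank (linearIndependent_pair hwF) (by rw [hE]; rfl)

theorem coe_pairBasis (hE : Module.finrank F E = 2) {w : E}
    (hwF : (w : Ω) ∉ Set.range (algebraMap F Ω)) : ⇑(pairBasis hE hwF) = ![1, w] :=
  coe_basisOfLinearIndependentOfCardEqFinrank _ _

theorem coe_eq_repr_pairBasis (hE : Module.finrank F E = 2) {w : E}
    (hwF : (w : Ω) ∉ Set.range (algebraMap F Ω)) (x : E) :
    (x : Ω) = algebraMap F Ω ((pairBasis hE hwF).repr x 0) +
      algebraMap F Ω ((pairBasis hE hwF).repr x 1) * w := by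
  have hrepr := congrArg (algebraMap E Ω) ((pairBasis hE hwF).sum_repr x)
  rw [Fin.sum_univ_two, coe_pairBasis] at hrepr
  refine hrepr.symm.trans ?_
  simp [Algebra.smul_def]

theorem exists_eq_add_mul (hE : Module.finrank F E = 2) {w : Ω} (hw : w ∈ E)
    (hwF : w ∉ Set.range (algebraMap F Ω)) {x : Ω} (hx : x ∈ E) :
    ∃ a b : F, x = algebraMap F Ω a + algebraMap F Ω b * w :=
  ⟨_, _, coe_eq_repr_pairBasis (w := ⟨w, hw⟩) hE hwF ⟨x, hx⟩⟩

namespace IsDyadicBase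

variable {N : AbsoluteValue Ω ℝ} {ρ : ℝ} {q e : ℕ} (H : IsDyadicBase F N ρ q e) {w : Ω}
include H

theorem map_pos_of_sq (hw : N w ^ 2 = ρ) : 0 < N w := by
  refine (N.nonneg w).lt_of_ne' fun hw0 => H.dyadic.pos.ne ?_
  rw [← hw, hw0, zero_pow _root_.two_ne_zero]

theorem map_add_mul (hw : N w ^ 2 = ρ) (a b : F) :
    N (algebraMap F Ω a + algebraMap F Ω b * w) =
      max (restrictAbs F N a) (restrictAbs F N b * N w) := by
  have hmul : N (algebraMap F Ω b * w) = restrictAbs F N b * N w := map_mul _ _ _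
  by_cases hb : b = 0
  · rw [hb, map_zero, map_zero, zero_mul, zero_mul, add_zero,
      max_eq_left (AbsoluteValue.nonneg _ _), restrictAbs_apply]
  have hne : N (algebraMap F Ω a) ≠ N (algebraMap F Ω b * w) := by
    intro heq
    have hb' : N (algebraMap F Ω b) ≠ 0 := N.ne_zero (by simpa using hb)
    refine H.notMem_range_of_sq (x := algebraMap F Ω (a / b)) ?_ ⟨a / b, rfl⟩
    rw [map_div₀, map_div₀, heq, map_mul, mul_div_cancel_left₀ _ hb', hw]
  rw [H.nonarch.add_eq_max_of_ne hne, hmul]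
  rfl

theorem mul_lt_one_of_le (hw : N w ^ 2 = ρ) {b : F} (hb : restrictAbs F N b * N w ≤ 1) :
    restrictAbs F N b * N w < 1 := by
  refine hb.lt_of_ne fun hbw => H.notMem_range_of_sq (x := algebraMap F Ω b⁻¹) ?_ ⟨b⁻¹, rfl⟩
  rw [← restrictAbs_apply, map_inv₀, inv_eq_of_mul_eq_one_right hbw, hw]

theorem exists_eq_zpow_of_mem (hE : Module.finrank F E = 2) (hwE : w ∈ E) (hw : N w ^ 2 = ρ)
    {x : Ω} (hx : x ∈ E) (hx0 : x ≠ 0) : ∃ n : ℤ, N x = N w ^ n := by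
  obtain ⟨a, b, rfl⟩ := exists_eq_add_mul hE hwE (H.notMem_range_of_sq hw) hx
  have hzpow (c : F) (hc : c ≠ 0) : ∃ n : ℤ, restrictAbs F N c = N w ^ (2 * n) := by
    obtain ⟨n, hn⟩ := H.dyadic.exists_zpow c hc
    exact ⟨n, by rw [hn, ← hw, zpow_mul]; rfl⟩
  have hpos := N.pos hx0
  rw [H.map_add_mul hw] at hpos ⊢
  rcases max_choice (restrictAbs F N a) (restrictAbs F N b * N w) with hmax | hmax <;>
    rw [hmax] at hpos ⊢
  · obtain ⟨n, hn⟩ := hzpow a (by rintro rfl; simp at hpos)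
    exact ⟨_, hn⟩
  · obtain ⟨n, hn⟩ := hzpow b (by rintro rfl; simp at hpos)
    exact ⟨2 * n + 1, by rw [hn, zpow_add_one₀ (H.map_pos_of_sq hw).ne']⟩

theorem nonempty_residueOf_ringEquiv_of_sq (hE : Module.finrank F E = 2) (hwE : w ∈ E)
    (hw : N w ^ 2 = ρ) : Nonempty (residueOf (restrictAbs F N) H.dyadic.nonarch ≃+*
      residueOf (restrictAbs E N) (isNonarchimedean_restrictAbs H.nonarch)) := by
  refine nonempty_residueOf_ringEquiv (fun _ => rfl) ?_
  rintro ⟨y, hyE⟩ hy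
  obtain ⟨a, b, rfl⟩ := exists_eq_add_mul hE hwE (H.notMem_range_of_sq hw) hyE
  replace hy : N (algebraMap F Ω a + algebraMap F Ω b * w) ≤ 1 := hy
  rw [H.map_add_mul hw, max_le_iff] at hy
  refine ⟨a, hy.1, ?_⟩
  change N (algebraMap F Ω a - (algebraMap F Ω a + algebraMap F Ω b * w)) < 1
  rw [sub_add_cancel_left, N.map_neg, map_mul]
  exact H.mul_lt_one_of_le hw hy.2

theorem extend [IsGalois F Ω] [IsAlgClosed Ω] (hE : Module.finrank F E = 2) (hwE : w ∈ E)
    (hw : N w ^ 2 = ρ) : IsDyadicBase E N (N w) q (2 * e) := by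
  have hinv : ∀ (σ : Ω ≃ₐ[E] Ω) (x : Ω), N (σ x) = N x :=
    fun σ x => H.map_algEquiv (σ.restrictScalars F) x
  obtain ⟨f⟩ := H.nonempty_residueOf_ringEquiv_of_sq hE hwE hw
  have := H.dyadic.finite_residue
  exact {
    nonarch := H.nonarch
    map_algEquiv := hinv
    dyadic := {
      nonarch := isNonarchimedean_restrictAbs H.nonarch
      pos := H.map_pos_of_sq hw
      lt_one := by
        by_contra! hge
        nlinarith [H.dyadic.lt_one]
      exists_uniformizer := ⟨⟨w, hwE⟩, rfl⟩
      exists_zpow := fun x hx => H.exists_eq_zpow_of_mem hE hwE hw x.2 (by simpa using hx)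
      map_two := by
        have h2 := H.dyadic.map_two
        rw [restrictAbs_apply, map_ofNat] at h2
        rw [restrictAbs_apply, map_ofNat, h2, ← hw, ← pow_mul]
      e_pos := Nat.mul_pos two_pos H.dyadic.e_pos
      finite_residue := Finite.of_equiv _ f.toEquiv
      card_residue := by rw [← Nat.card_congr f.toEquiv, H.dyadic.card_residue]
      exists_artinSchreier := fun c hc => exists_artinSchreier_root H.nonarch hinv c hc } }

end IsDyadicBase

end Quadratic

theorem sum_inv_pow_disc {q : ℝ} (hq : q ≠ 0) (e : ℕ) :
    2 * q ^ e * (q ^ (2 * e + 1))⁻¹ +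
      ∑ i ∈ Finset.range e, 2 * (q - 1) * q ^ i * (q ^ (2 * (i + 1)))⁻¹ = 2 * q⁻¹ := by
  induction e with
  | zero => simp
  | succ e ih =>
    rw [Finset.sum_range_succ, eq_sub_of_add_eq' ih]
    field_simp
    ring

theorem sum_inv_sq_pow_disc {q : ℝ} (hq : 0 < q) (e : ℕ) :
    2 * q ^ e * ((q ^ (2 * e + 1)) ^ 2)⁻¹ +
      ∑ i ∈ Finset.range e, 2 * (q - 1) * q ^ i * ((q ^ (2 * (i + 1))) ^ 2)⁻¹ =
      2 * q * (1 / (q ^ 2 + q + 1) *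
        (q ^ (-3 * (e : ℤ) - 3) + q ^ (-3 * (e : ℤ) - 1) + q ^ (-2 : ℤ))) := by
  have hneg (n : ℕ) : q ^ (-3 * (e : ℤ) - n) = (q ^ (3 * e + n))⁻¹ := by
    rw [← zpow_natCast, ← zpow_neg]
    congr 1
    push_cast
    ring
  have hgeom : 2 * q ^ e * ((q ^ (2 * e + 1)) ^ 2)⁻¹ +
      ∑ i ∈ Finset.range e, 2 * (q - 1) * q ^ i * ((q ^ (2 * (i + 1))) ^ 2)⁻¹ =
      2 * q / (q ^ 2 + q + 1) * ((q ^ (3 * e + 3))⁻¹ + (q ^ (3 * e + 1))⁻¹ + (q ^ 2)⁻¹) := by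
    clear hneg
    induction e with
    | zero =>
      simp only [Finset.range_zero, Finset.sum_empty]
      field_simp
      ring
    | succ e ih =>
      rw [Finset.sum_range_succ, eq_sub_of_add_eq' ih]
      field_simp
      ring
  have hneg_three := hneg 3
  have hneg_one := hneg 1
  push_cast at hneg_three hneg_one
  rw [hgeom, hneg_three, hneg_one, zpow_neg, zpow_ofNat]
  ring

/-! ### Quadratic subextensions and the Galois group -/

section Groups

open scoped Pointwise

variable {G : Type*} [Group G]

/-- The subgroups of index two containing `H`. -/
def indexTwo (H : Subgroup G) : Set (Subgroup G) := {M | H ≤ M ∧ M.index = 2}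

theorem nonempty_mulEquiv_of_injective_of_card {p : ℕ} [Fact p.Prime] {A B P : Type*} [Group A]
    [Group B] [Group P] [Finite P] {f : A →* P} {g : B →* P} (hf : Function.Injective f)
    (hg : Function.Injective g) (hA : Nat.card A = p ^ (Nat.card P).factorization p)
    (hB : Nat.card B = p ^ (Nat.card P).factorization p) : Nonempty (A ≃* B) := by
  let S : Sylow p P := Sylow.ofCard f.range
    ((Nat.card_congr (MonoidHom.ofInjective hf).toEquiv).symm.trans hA)
  let T : Sylow p P := Sylow.ofCard g.range
    ((Nat.card_congr (MonoidHom.ofInjective hg).toEquiv).symm.trans hB)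
  exact ⟨(MonoidHom.ofInjective hf).trans ((S.equiv T).trans (MonoidHom.ofInjective hg).symm)⟩

theorem exists_injective_perm_of_normalCore_eq_bot {H : Subgroup G} {n : ℕ} [NeZero n]
    (hidx : H.index = n) (hcore : H.normalCore = ⊥) :
    ∃ f : G →* Equiv.Perm (Fin n), Function.Injective f := by
  have : Finite (G ⧸ H) := Nat.finite_of_card_ne_zero (hidx.trans_ne (NeZero.ne n))
  let φ := (Finite.equivFinOfCardEq hidx).permCongrHom
  refine ⟨φ.toMonoidHom.comp (MulAction.toPermHom G (G ⧸ H)), φ.injective.comp ?_⟩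
  rw [← MonoidHom.ker_eq_bot_iff, ← H.normalCore_eq_ker, hcore]

/-- The action of the dihedral group on the vertices of a regular `n`-gon, labelled by `ZMod n`;
it is used to recognise `D4` as a Sylow subgroup of the symmetric group. -/
def dihedralPerm (n : ℕ) : DihedralGroup n →* Equiv.Perm (ZMod n) :=
  MonoidHom.mk' (fun
    | .r i => Equiv.addLeft i
    | .sr i => Equiv.subLeft (-i)) (by
    rintro (i | i) (j | j) <;> ext x <;>
      simp only [DihedralGroup.r_mul_r, DihedralGroup.r_mul_sr, DihedralGroup.sr_mul_r,
        DihedralGroup.sr_mul_sr, Equiv.Perm.mul_apply, Equiv.coe_addLeft, Equiv.subLeft_apply] <;>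
      ring)

theorem nonempty_mulEquiv_D4 {H : Subgroup G} (hidx : H.index = 4) (hcore : H.normalCore = ⊥)
    (hcard : Nat.card G = 8) : Nonempty (G ≃* D4) := by
  obtain ⟨f, hf⟩ := exists_injective_perm_of_normalCore_eq_bot hidx hcore
  have hd : Function.Injective (dihedralPerm 4) := by decide
  have hperm : 2 ^ (Nat.card (Equiv.Perm (Fin 4))).factorization 2 = 8 := by
    rw [Nat.card_perm, Nat.card_fin, show Nat.factorial 4 = 2 ^ 3 * 3 by decide,
      Nat.factorization_mul (by norm_num) (by norm_num), Nat.factorization_pow,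
      Nat.Prime.factorization Nat.prime_two, Nat.Prime.factorization Nat.prime_three]
    simp
  exact nonempty_mulEquiv_of_injective_of_card (P := Equiv.Perm (Fin 4)) (g := dihedralPerm 4)
    hf hd (hcard.trans hperm.symm) (DihedralGroup.nat_card.trans hperm.symm)

theorem card_eq_of_mem_indexTwo {H M : Subgroup G} (hidx : H.index = 4)
    (hcore : H.normalCore = ⊥) (hM : M ∈ indexTwo H) : Nat.card G = 4 ∨ Nat.card G = 8 := by
  obtain ⟨f, hf⟩ := exists_injective_perm_of_normalCore_eq_bot hidx hcore
  have : Finite G := Finite.of_injective f hf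
  obtain ⟨hHM, hM⟩ := hM
  have hMn : M.Normal := Subgroup.normal_of_index_eq_two hM
  have hrel : H.relIndex M = 2 := by
    have := Subgroup.relIndex_mul_index hHM
    lia
  have hHn : (H.subgroupOf M).Normal := Subgroup.normal_of_index_eq_two hrel
  have hconj {m x : G} (hm : m ∈ M) (hx : x ∈ H) : m * x * m⁻¹ ∈ H :=
    hHn.conj_mem ⟨x, hHM hx⟩ hx ⟨m, hm⟩
  obtain ⟨g, hg⟩ : ∃ g, g ∉ M := by
    by_contra! hall
    rw [(Subgroup.eq_top_iff' M).2 hall, Subgroup.index_top] at hM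
    norm_num at hM
  have hinf : H ⊓ MulAut.conj g • H = ⊥ := by
    rw [eq_bot_iff, ← hcore]
    rintro y ⟨hy, hy'⟩ x
    by_cases hx : x ∈ M
    · exact hconj hx hy
    · have hxg : x * g ∈ M := (Subgroup.mul_mem_iff_of_index_two hM).2 (iff_of_false hx hg)
      obtain ⟨z, hz, rfl⟩ := hy'
      have := hconj hxg hz
      simpa [mul_assoc] using this
  have hrel' : (MulAut.conj g • H).relIndex M = 2 := by
    rw [← hrel, ← Subgroup.relIndex_pointwise_smul (MulAut.conj g) H M,
      Subgroup.Normal.conj_smul_eq_self g M]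
  have hle := Subgroup.relIndex_inf_le (H := H) (K := MulAut.conj g • H) (L := M)
  rw [hinf, Subgroup.relIndex_bot_left, hrel, hrel'] at hle
  have hMcard := M.card_mul_index
  have hHcard := H.card_mul_index
  have hpos : 0 < Nat.card H := Nat.card_pos
  lia

theorem nonempty_mulEquiv_C4_or_V4 (hcard : Nat.card G = 4) :
    Nonempty (G ≃* C4) ∨ Nonempty (G ≃* V4) := by
  by_cases hcyc : IsCyclic G
  · exact Or.inl ⟨mulEquivOfCyclicCardEq (by simp [hcard])⟩
  · have : IsKleinFour G :=
      ⟨hcard, (not_isCyclic_iff_exponent_eq_prime Nat.prime_two hcard).1 hcyc⟩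
    exact Or.inr IsKleinFour.nonempty_mulEquiv

theorem nonempty_mulEquiv_of_indexTwo_nonempty {H : Subgroup G} (hidx : H.index = 4)
    (hcore : H.normalCore = ⊥) (hne : (indexTwo H).Nonempty) :
    Nonempty (G ≃* D4) ∨ Nonempty (G ≃* C4) ∨ Nonempty (G ≃* V4) := by
  obtain ⟨M, hM⟩ := hne
  rcases card_eq_of_mem_indexTwo hidx hcore hM with hcard | hcard
  · exact Or.inr (nonempty_mulEquiv_C4_or_V4 hcard)
  · exact Or.inl (nonempty_mulEquiv_D4 hidx hcore hcard)

theorem indexTwo_nonempty [Finite G] {H : Subgroup G} (hidx : H.index = 4)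
    {n : ℕ} (hcard : Nat.card G = 2 ^ (n + 1)) : (indexTwo H).Nonempty := by
  have : Fact (Nat.Prime 2) := ⟨Nat.prime_two⟩
  have hdvd : Nat.card H ∣ 2 ^ (n + 1) := hcard ▸ H.card_subgroup_dvd_card
  obtain ⟨m, -, hm⟩ := (Nat.dvd_prime_pow Nat.prime_two).1 hdvd
  have hH := H.card_mul_index
  have hmn : m ≤ n := by
    rw [hidx, hcard, hm, show 4 = 2 ^ 2 by rfl, ← pow_add] at hH
    have := Nat.pow_right_injective le_rfl hH
    lia
  obtain ⟨M, hM, hle⟩ := Sylow.exists_subgroup_card_pow_prime_le 2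
    (hcard ▸ pow_dvd_pow 2 n.le_succ) H hm hmn
  refine ⟨M, hle, ?_⟩
  have hMG := M.card_mul_index
  rw [hM, hcard, pow_succ] at hMG
  exact Nat.eq_of_mul_eq_mul_left (by positivity) hMG

theorem index_inf_eq_four {M M' : Subgroup G} (hM : M.index = 2) (hM' : M'.index = 2)
    (hne : M ≠ M') : (M ⊓ M').index = 4 := by
  have hnotle : ¬ M ≤ M' := fun hle => hne <| le_antisymm hle <| Subgroup.relIndex_eq_one.1 <| by
    have := Subgroup.relIndex_mul_index hle
    lia
  have hM'n : M'.Normal := Subgroup.normal_of_index_eq_two hM'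
  have hrel : M'.relIndex M = 2 :=
    ((Nat.dvd_prime Nat.prime_two).1 (hM' ▸ M'.relIndex_dvd_index_of_normal M)).resolve_left
      (hnotle ∘ Subgroup.relIndex_eq_one.1)
  rw [← Subgroup.relIndex_mul_index (inf_le_left : M ⊓ M' ≤ M), Subgroup.inf_relIndex_left,
    hM, hrel]

theorem sq_eq_one_of_indexTwo_nontrivial {H : Subgroup G} (hidx : H.index = 4)
    (hcore : H.normalCore = ⊥) (hnt : (indexTwo H).Nontrivial) (g : G) : g ^ 2 = 1 := by
  obtain ⟨M, hM, M', hM', hne⟩ := hnt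
  have hMn : M.Normal := Subgroup.normal_of_index_eq_two hM.2
  have hMn' : M'.Normal := Subgroup.normal_of_index_eq_two hM'.2
  have hle : H ≤ M ⊓ M' := le_inf hM.1 hM'.1
  have heq : H = M ⊓ M' := by
    refine le_antisymm hle (Subgroup.relIndex_eq_one.1 ?_)
    have := Subgroup.relIndex_mul_index hle
    have := index_inf_eq_four hM.2 hM'.2 hne
    lia
  have hbot : M ⊓ M' = ⊥ := by rw [← hcore, heq, Subgroup.normalCore_eq_self]
  rw [← Subgroup.mem_bot, ← hbot]
  exact ⟨Subgroup.sq_mem_of_index_two hM.2 g, Subgroup.sq_mem_of_index_two hM'.2 g⟩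

theorem ncard_indexTwo_eq_one [Finite G] {H : Subgroup G} (hidx : H.index = 4)
    (hcore : H.normalCore = ⊥) {n : ℕ} (hcard : Nat.card G = 2 ^ (n + 1)) {g : G}
    (hg : g ^ 2 ≠ 1) : (indexTwo H).ncard = 1 := by
  obtain ⟨M, hM⟩ := indexTwo_nonempty hidx hcard
  have hsub : (indexTwo H).Subsingleton := by
    by_contra hnt
    exact hg (sq_eq_one_of_indexTwo_nontrivial hidx hcore (Set.not_subsingleton_iff.1 hnt) g)
  exact Set.ncard_eq_one.2 ⟨M, hsub.eq_singleton_of_mem hM⟩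

theorem ncard_indexTwo_D4 {H : Subgroup G} (hidx : H.index = 4)
    (hcore : H.normalCore = ⊥) (f : G ≃* D4) : (indexTwo H).ncard = 1 := by
  have : Finite G := Finite.of_equiv _ f.symm.toEquiv
  refine ncard_indexTwo_eq_one hidx hcore (n := 2) ?_ (g := f.symm (DihedralGroup.r 1)) ?_
  · rw [Nat.card_congr f.toEquiv, DihedralGroup.nat_card]
    rfl
  · rw [← map_pow, ne_eq, EmbeddingLike.map_eq_one_iff]
    decide

theorem ncard_indexTwo_C4 {H : Subgroup G} (hidx : H.index = 4)
    (hcore : H.normalCore = ⊥) (f : G ≃* C4) : (indexTwo H).ncard = 1 := by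
  have : Finite G := Finite.of_equiv _ f.symm.toEquiv
  refine ncard_indexTwo_eq_one hidx hcore (n := 1) ?_ (g := f.symm (Multiplicative.ofAdd 1)) ?_
  · rw [Nat.card_congr f.toEquiv]
    simp
  · rw [← map_pow, ne_eq, EmbeddingLike.map_eq_one_iff]
    decide

section KleinFour

open scoped IsKleinFour

variable [IsKleinFour G]

theorem orderOf_eq_two_of_isKleinFour {g : G} (hg : g ≠ 1) : orderOf g = 2 :=
  orderOf_eq_prime ((pow_two g).trans (IsKleinFour.mul_self g)) hg

theorem injOn_zpowers_of_isKleinFour :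
    Set.InjOn (Subgroup.zpowers : G → Subgroup G) {1}ᶜ := by
  intro a ha b _ hab
  obtain ⟨n, rfl⟩ := Subgroup.mem_zpowers_iff.1 (hab ▸ Subgroup.mem_zpowers a)
  have hb2 : b ^ 2 = 1 := (pow_two b).trans (IsKleinFour.mul_self b)
  rcases Int.even_or_odd' n with ⟨m, rfl | rfl⟩
  · rw [zpow_mul, zpow_ofNat, hb2, one_zpow] at ha
    exact absurd rfl ha
  · rw [zpow_add, zpow_mul, zpow_ofNat, hb2, one_zpow, one_mul, zpow_one]

theorem index_eq_two_iff_of_isKleinFour {M : Subgroup G} :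
    M.index = 2 ↔ ∃ g ≠ 1, Subgroup.zpowers g = M := by
  have hcard := M.card_mul_index
  rw [IsKleinFour.card_four (G := G)] at hcard
  constructor
  · intro hM
    obtain rfl | ⟨g, hgM, hg⟩ := M.bot_or_exists_ne_one
    · rw [Subgroup.card_bot] at hcard
      lia
    · refine ⟨g, hg, Subgroup.eq_of_le_of_card_ge (Subgroup.zpowers_le.2 hgM) ?_⟩
      rw [Nat.card_zpowers, orderOf_eq_two_of_isKleinFour hg]
      lia
  · rintro ⟨g, hg, rfl⟩
    rw [Nat.card_zpowers, orderOf_eq_two_of_isKleinFour hg] at hcard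
    lia

theorem ncard_index_eq_two_of_isKleinFour : {M : Subgroup G | M.index = 2}.ncard = 3 := by
  have himg : {M : Subgroup G | M.index = 2} = Subgroup.zpowers '' ({1}ᶜ : Set G) :=
    Set.ext fun _ => index_eq_two_iff_of_isKleinFour
  have hcompl := Set.ncard_add_ncard_compl ({1} : Set G)
  rw [Set.ncard_singleton, IsKleinFour.card_four] at hcompl
  rw [himg, injOn_zpowers_of_isKleinFour.ncard_image]
  lia

end KleinFour

theorem ncard_indexTwo_V4 {H : Subgroup G} (hidx : H.index = 4) (f : G ≃* V4) :
    (indexTwo H).ncard = 3 := by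
  have hcard : Nat.card G = 4 := by
    rw [Nat.card_congr f.toEquiv]
    simp
  have : IsKleinFour G :=
    ⟨hcard, (Monoid.exponent_eq_of_mulEquiv f).trans IsKleinFour.exponent_two⟩
  have hH : H = ⊥ := by
    have := H.card_mul_index
    exact Subgroup.card_eq_one.1 (by lia)
  simp only [indexTwo, hH, bot_le, true_and, ncard_index_eq_two_of_isKleinFour]

end Groups

section QuadraticSubfields

open IntermediateField

variable {K : Type*} [Field K]

/-- The subextensions of `L` which are quadratic over the base field. -/
def quadSub {Ω : Type*} [Field Ω] [Algebra K Ω] (L : IntermediateField K Ω) :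
    Set (IntermediateField K Ω) := {E | E ≤ L ∧ Module.finrank K E = 2}

theorem nonempty_galoisClosureGroup_mulEquiv {L L' : IntermediateField K (AlgebraicClosure K)}
    (f : L ≃ₐ[K] L') : Nonempty (GaloisClosureGroup K L ≃* GaloisClosureGroup K L') := by
  have h : normalClosure K L (AlgebraicClosure K) = normalClosure K L' (AlgebraicClosure K) := by
    rw [normalClosure_def, normalClosure_def]
    exact (f.arrowCongr AlgEquiv.refl).iSup_congr fun g =>
      SetLike.coe_injective (f.symm.surjective.range_comp g)
  exact ⟨(equivOfEq h).autCongr⟩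

/-- The Galois group of the normal closure of `L` over `L`, as a subgroup of its Galois group
over `K`. -/
noncomputable def relGaloisGroup (L : IntermediateField K (AlgebraicClosure K)) :
    Subgroup (GaloisClosureGroup K L) :=
  (restrict L.le_normalClosure).fixingSubgroup

variable [PerfectField K]

instance isGalois_normalClosure (L : IntermediateField K (AlgebraicClosure K)) :
    IsGalois K (normalClosure K L (AlgebraicClosure K)) where

variable (L : IntermediateField K (AlgebraicClosure K))

theorem index_relGaloisGroup : (relGaloisGroup L).index = Module.finrank K L := by
  rw [relGaloisGroup, ← finrank_eq_fixingSubgroup_index]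
  exact (restrictAlgEquiv L.le_normalClosure).toLinearEquiv.finrank_eq.symm

variable [FiniteDimensional K L]

theorem normalCore_relGaloisGroup : (relGaloisGroup L).normalCore = ⊥ := by
  set C := (relGaloisGroup L).normalCore
  have hle : L ≤ lift (fixedField C) := by
    refine (lift_restrict L.le_normalClosure).symm.le.trans (map_mono _ ?_)
    rw [le_iff_le]
    exact Subgroup.normalCore_le _
  have hnormal : Normal K (lift (fixedField C)) := Normal.of_algEquiv (liftAlgEquiv _)
  have htop : fixedField C = ⊤ := by
    rw [eq_top_iff]
    intro x _
    exact (mem_lift x).1 (normalClosure_le_iff_of_normal.2 hle x.2)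
  rw [← fixingSubgroup_fixedField C, htop, fixingSubgroup_top]

theorem quadSub_eq_image_indexTwo :
    quadSub L = (fun M => lift (fixedField M)) '' indexTwo (relGaloisGroup L) := by
  ext E
  constructor
  · rintro ⟨hE, hrank⟩
    have hE' := hE.trans L.le_normalClosure
    refine ⟨(restrict hE').fixingSubgroup, ⟨fixingSubgroup_le fun x hx => ?_, ?_⟩, ?_⟩
    · rw [mem_restrict] at hx ⊢
      exact hE hx
    · rw [← finrank_eq_fixingSubgroup_index, ← hrank]
      exact (restrictAlgEquiv hE').toLinearEquiv.finrank_eq.symm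
    · dsimp only
      rw [IsGalois.fixedField_fixingSubgroup, lift_restrict]
  · rintro ⟨M, ⟨hM, hM2⟩, rfl⟩
    constructor
    · refine (map_mono _ ?_).trans (lift_restrict L.le_normalClosure).le
      rw [← IsGalois.fixedField_fixingSubgroup (restrict L.le_normalClosure)]
      exact fixedField_antitone hM
    · dsimp only
      rw [← (liftAlgEquiv (fixedField M)).toLinearEquiv.finrank_eq,
        finrank_eq_fixingSubgroup_index, fixingSubgroup_fixedField, hM2]

theorem ncard_quadSub : (quadSub L).ncard = (indexTwo (relGaloisGroup L)).ncard := by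
  rw [quadSub_eq_image_indexTwo, Set.ncard_image_of_injective]
  intro M M' h
  rw [← fixingSubgroup_fixedField M, lift_injective _ h, fixingSubgroup_fixedField M']

end QuadraticSubfields

/-! ### Local fields -/

section DiscreteValuationRing

open IsLocalRing

variable {S M : Type*} [CommRing S] [IsDomain S] [IsDiscreteValuationRing S] [Monoid M]
  {ν : S →* M}

theorem map_eq_pow_multiplicity (hν : ∀ x, IsUnit x → ν x = 1) {ϖ : S} (hϖ : Irreducible ϖ)
    {x : S} (hx : x ≠ 0) : ν x = ν ϖ ^ multiplicity (maximalIdeal S) (Ideal.span {x}) := by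
  obtain ⟨n, u, hu⟩ := IsDiscreteValuationRing.associated_pow_irreducible hx hϖ
  have hspan : Ideal.span {x} = maximalIdeal S ^ n := by
    rw [(IsDiscreteValuationRing.irreducible_iff_uniformizer ϖ).1 hϖ, Ideal.span_singleton_pow,
      ← hu]
    exact (Ideal.span_singleton_mul_right_unit u.isUnit x).symm
  have hunit : ¬ IsUnit (maximalIdeal S) := by
    rw [Ideal.isUnit_iff]
    exact (maximalIdeal.isMaximal S).ne_top
  rw [hspan, multiplicity_pow_self (IsDiscreteValuationRing.not_a_field S) hunit, ← map_pow, ← hu,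
    map_mul, hν u u.isUnit, mul_one]

theorem map_algebraMap_eq_pow_ramificationIdx {R : Type*} [CommRing R] [IsLocalRing R]
    [Algebra R S] [Algebra.IsIntegral R S] (hν : ∀ x, IsUnit x → ν x = 1) {ϖ : S}
    (hϖ : Irreducible ϖ) {p : R} (hp : maximalIdeal R = Ideal.span {p})
    (hp0 : algebraMap R S p ≠ 0) :
    ν (algebraMap R S p) = ν ϖ ^ (maximalIdeal S).ramificationIdx R := by
  have hlies : (maximalIdeal S).LiesOver (maximalIdeal R) :=
    ⟨(eq_maximalIdeal (Ideal.isMaximal_comap_of_isIntegral_of_isMaximal _)).symm⟩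
  have hmap : (maximalIdeal R).map (algebraMap R S) = Ideal.span {algebraMap R S p} := by
    rw [hp, Ideal.map_span, Set.image_singleton]
  rw [map_eq_pow_multiplicity hν hϖ hp0,
    Ideal.IsDedekindDomain.ramificationIdx_eq_multiplicity (maximalIdeal R), hmap]
  rwa [hmap, ne_eq, Ideal.span_singleton_eq_bot]

end DiscreteValuationRing

section UnitBallSubring

variable {F S : Type*} [Field F] [SetLike S F] [SubringClass S F] {A : S} {v : AbsoluteValue F ℝ}
  {hv : IsNonarchimedean v}

variable (hv) in
/-- A subring which consists of the elements of absolute value at most one, identified with the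
unit ball. -/
def equivUnitBall (hA : ∀ x, x ∈ A ↔ v x ≤ 1) : A ≃+* unitBall v hv where
  toFun x := ⟨x, (hA x).1 x.2⟩
  invFun x := ⟨x, (hA x).2 x.2⟩
  map_mul' _ _ := rfl
  map_add' _ _ := rfl

include hv

theorem isUnit_iff_of_mem_iff (hA : ∀ x, x ∈ A ↔ v x ≤ 1) (x : A) :
    IsUnit x ↔ v (x : F) = 1 := by
  rw [← MulEquiv.isUnit_map (equivUnitBall hv hA), isUnit_unitBall]
  rfl

theorem isLocalRing_of_mem_iff (hA : ∀ x, x ∈ A ↔ v x ≤ 1) : IsLocalRing A :=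
  (equivUnitBall hv hA).symm.isLocalRing

end UnitBallSubring

section ClosureAbs

variable (K : Type*) [Field K] [Algebra ℚ_[2] K]

instance charZero_of_algebra_padic : CharZero K :=
  charZero_of_injective_algebraMap (algebraMap ℚ_[2] K).injective

instance isGalois_algebraicClosure : IsGalois K (AlgebraicClosure K) where

variable [FiniteDimensional ℚ_[2] K]

instance isAlgebraic_algebraicClosure : Algebra.IsAlgebraic ℚ_[2] (AlgebraicClosure K) :=
  Algebra.IsAlgebraic.trans ℚ_[2] K (AlgebraicClosure K)

/-- The extension of the `2`-adic absolute value to the algebraic closure of a `2`-adic field. -/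
noncomputable def closureAbs : AbsoluteValue (AlgebraicClosure K) ℝ where
  toFun := spectralNorm ℚ_[2] (AlgebraicClosure K)
  map_mul' := map_mul (spectralMulAlgNorm ℚ_[2] (AlgebraicClosure K))
  nonneg' := spectralNorm_nonneg
  eq_zero' _ := map_eq_zero_iff_eq_zero (spectralMulAlgNorm ℚ_[2] (AlgebraicClosure K))
  add_le' := map_add_le_add (spectralMulAlgNorm ℚ_[2] (AlgebraicClosure K))

theorem isNonarchimedean_closureAbs : IsNonarchimedean (closureAbs K) :=
  isNonarchimedean_spectralNorm

theorem closureAbs_algEquiv (σ : AlgebraicClosure K ≃ₐ[K] AlgebraicClosure K)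
    (x : AlgebraicClosure K) : closureAbs K (σ x) = closureAbs K x :=
  (spectralNorm_eq_of_equiv (σ.restrictScalars ℚ_[2]) x).symm

/-- The extension of the `2`-adic absolute value to a `2`-adic field. -/
noncomputable abbrev baseAbs : AbsoluteValue K ℝ := restrictAbs K (closureAbs K)

theorem isNonarchimedean_baseAbs : IsNonarchimedean (baseAbs K) :=
  isNonarchimedean_restrictAbs (isNonarchimedean_closureAbs K)

theorem baseAbs_two_lt_one : baseAbs K 2 < 1 := by
  have hspec : closureAbs K (algebraMap ℚ_[2] (AlgebraicClosure K) 2) = ‖(2 : ℚ_[2])‖ :=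
    spectralNorm_extends _
  rw [restrictAbs_apply, map_ofNat, ← map_ofNat (algebraMap ℚ_[2] (AlgebraicClosure K)) 2, hspec]
  exact_mod_cast Padic.norm_p_lt_one (p := 2)

variable [Algebra ℤ_[2] K] [IsScalarTower ℤ_[2] ℚ_[2] K]

variable {K} in
theorem mem_integers_iff (x : K) : x ∈ integers K ↔ baseAbs K x ≤ 1 := by
  rw [mem_integralClosure_iff, ← isIntegral_algebraMap_iff (B := AlgebraicClosure K)
    (algebraMap K (AlgebraicClosure K)).injective]
  exact isIntegral_iff_spectralNorm_le_one _

variable {K} in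
theorem mem_integersOver_iff (L : IntermediateField K (AlgebraicClosure K)) (x : L) :
    x ∈ integersOver K L ↔ restrictAbs L (closureAbs K) x ≤ 1 := by
  rw [mem_integralClosure_iff, ← isIntegral_algebraMap_iff (B := AlgebraicClosure K)
    (algebraMap L (AlgebraicClosure K)).injective]
  have : Algebra.IsIntegral ℤ_[2] (integers K) := integralClosure.AlgebraIsIntegral ..
  exact Iff.trans ⟨fun hx => isIntegral_trans _ hx, fun hx => hx.tower_top⟩
    (isIntegral_iff_spectralNorm_le_one _)

variable {K} in
theorem isUnit_integers_iff (x : integers K) : IsUnit x ↔ baseAbs K x = 1 :=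
  isUnit_iff_of_mem_iff (hv := isNonarchimedean_baseAbs K) mem_integers_iff x

variable {K} in
theorem isUnit_integersOver_iff {L : IntermediateField K (AlgebraicClosure K)}
    (x : integersOver K L) : IsUnit x ↔ closureAbs K (x : L) = 1 :=
  isUnit_iff_of_mem_iff (hv := isNonarchimedean_restrictAbs (isNonarchimedean_closureAbs K))
    (mem_integersOver_iff L) x

instance isLocalRing_integersOver (L : IntermediateField K (AlgebraicClosure K)) :
    IsLocalRing (integersOver K L) :=
  isLocalRing_of_mem_iff (hv := isNonarchimedean_restrictAbs (isNonarchimedean_closureAbs K))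
    (mem_integersOver_iff L)

end ClosureAbs

section Integers

variable (K : Type*) [Field K] [Algebra ℚ_[2] K] [FiniteDimensional ℚ_[2] K]
  [Algebra ℤ_[2] K] [IsScalarTower ℤ_[2] ℚ_[2] K]

instance isDedekindDomain_integers : IsDedekindDomain (integers K) :=
  integralClosure.isDedekindDomain ℤ_[2] ℚ_[2] K

instance isFractionRing_integers : IsFractionRing (integers K) K :=
  integralClosure.isFractionRing_of_finite_extension ℚ_[2] K

instance finite_integers : Module.Finite ℤ_[2] (integers K) :=
  IsIntegralClosure.finite ℤ_[2] ℚ_[2] K (integers K)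

instance faithfulSMul_integers : FaithfulSMul ℤ_[2] (integers K) := by
  have hinj : Function.Injective (algebraMap ℤ_[2] K) := by
    rw [IsScalarTower.algebraMap_eq ℤ_[2] ℚ_[2] K]
    exact (algebraMap ℚ_[2] K).injective.comp (IsFractionRing.injective ℤ_[2] ℚ_[2])
  exact (faithfulSMul_iff_algebraMap_injective _ _).2 fun x y h => hinj (congrArg Subtype.val h)

theorem finite_residueField : Finite (IsLocalRing.ResidueField (integers K)) := by
  have : Finite (IsLocalRing.ResidueField ℤ_[2]) :=
    Finite.of_equiv (ZMod 2) (PadicInt.residueField (p := 2)).symm.toEquiv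
  exact IsLocalRing.ResidueField.finite_of_finite this

theorem one_lt_residueCard : 1 < residueCard K := by
  have := finite_residueField K
  exact Finite.one_lt_card

instance isDiscreteValuationRing_integers : IsDiscreteValuationRing (integers K) where
  not_a_field' hbot := by
    have hmem : (2 : integers K) ∈ IsLocalRing.maximalIdeal (integers K) := by
      rw [IsLocalRing.mem_maximalIdeal, mem_nonunits_iff, isUnit_integers_iff]
      exact (baseAbs_two_lt_one K).ne
    rw [hbot, Ideal.mem_bot] at hmem
    exact two_ne_zero (α := K) (congrArg Subtype.val hmem)

/-- The absolute value of `K` on its ring of integers, as a monoid homomorphism. -/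
noncomputable def integersAbs : integers K →* ℝ :=
  (baseAbs K : K →* ℝ).comp (algebraMap (integers K) K : integers K →* K)

theorem integersAbs_of_isUnit (x : integers K) (hx : IsUnit x) : integersAbs K x = 1 :=
  (isUnit_integers_iff x).1 hx

variable {K} {ϖ : integers K} (hϖ : Irreducible ϖ)
include hϖ

theorem baseAbs_eq_pow_multiplicity {x : integers K} (hx : x ≠ 0) : baseAbs K x =
    baseAbs K ϖ ^ multiplicity (IsLocalRing.maximalIdeal (integers K)) (Ideal.span {x}) :=
  map_eq_pow_multiplicity (integersAbs_of_isUnit K) hϖ hx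

theorem baseAbs_two : baseAbs K 2 = baseAbs K ϖ ^ absRamificationIdx K := by
  have hmap : algebraMap ℤ_[2] (integers K) (2 : ℕ) = 2 := by
    rw [map_natCast, Nat.cast_ofNat]
  have htwo : (2 : integers K) ≠ 0 := fun h =>
    two_ne_zero (α := K) (congrArg Subtype.val h)
  have h := map_algebraMap_eq_pow_ramificationIdx (integersAbs_of_isUnit K) hϖ
    PadicInt.maximalIdeal_eq_span_p (hmap.trans_ne htwo)
  rwa [hmap] at h

omit [IsScalarTower ℤ_[2] ℚ_[2] K] in
theorem baseAbs_pos : 0 < baseAbs K ϖ :=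
  (baseAbs K).pos fun h => hϖ.ne_zero (Subtype.ext h)

theorem exists_baseAbs_eq_zpow {x : K} (hx : x ≠ 0) : ∃ n : ℤ, baseAbs K x = baseAbs K ϖ ^ n := by
  obtain ⟨a, b, hb, rfl⟩ := IsFractionRing.div_surjective (A := integers K) x
  have ha : a ≠ 0 := by
    rintro rfl
    simp at hx
  have hdiv := map_div₀ (baseAbs K) (a : K) b
  rw [baseAbs_eq_pow_multiplicity hϖ ha,
    baseAbs_eq_pow_multiplicity hϖ (nonZeroDivisors.ne_zero hb), ← zpow_natCast, ← zpow_natCast,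
    ← zpow_sub₀ (baseAbs_pos hϖ).ne'] at hdiv
  exact ⟨_, hdiv⟩

theorem baseAbs_lt_one : baseAbs K ϖ < 1 :=
  lt_of_le_of_ne ((mem_integers_iff _).1 ϖ.2) fun h => hϖ.not_isUnit ((isUnit_integers_iff ϖ).2 h)

theorem isDyadicBase :
    IsDyadicBase K (closureAbs K) (baseAbs K ϖ) (residueCard K) (absRamificationIdx K) := by
  have hfin := finite_residueField K
  let f := IsLocalRing.ResidueField.mapEquiv
    (equivUnitBall (isNonarchimedean_baseAbs K) (mem_integers_iff (K := K)))
  exact {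
    nonarch := isNonarchimedean_closureAbs K
    map_algEquiv := closureAbs_algEquiv K
    dyadic := {
      nonarch := isNonarchimedean_baseAbs K
      pos := baseAbs_pos hϖ
      lt_one := baseAbs_lt_one hϖ
      exists_uniformizer := ⟨ϖ, rfl⟩
      exists_zpow := fun _ => exists_baseAbs_eq_zpow hϖ
      map_two := baseAbs_two hϖ
      e_pos := by
        refine Nat.pos_of_ne_zero fun he => (baseAbs_two_lt_one K).ne ?_
        rw [baseAbs_two hϖ, he, pow_zero]
      finite_residue := Finite.of_equiv _ f.toEquiv
      card_residue := (Nat.card_congr f.toEquiv).symm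
      exists_artinSchreier := fun c hc =>
        exists_artinSchreier_root (isNonarchimedean_closureAbs K) (closureAbs_algEquiv K) c hc } }

end Integers

/-! ### Discriminants in towers -/

section DiscrTower

open Matrix Kronecker

variable {R S T ι κ : Type*} [CommRing R] [CommRing S] [CommRing T] [Algebra R S] [Algebra S T]
  [Algebra R T] [IsScalarTower R S T] [Fintype ι] [DecidableEq ι]
  (b : Module.Basis ι R S) (c : Module.Basis κ S T)

theorem trace_smul_mul_smul [Finite κ] (i j : ι) (k l : κ) :
    Algebra.trace R T (b i • c k * b j • c l) =
      ∑ m, Algebra.traceMatrix R b i m *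
        Algebra.leftMulMatrix b (Algebra.traceMatrix S c k l) m j := by
  have := Module.Free.of_basis b
  have := Module.Free.of_basis c
  have := Module.Finite.of_basis b
  have := Module.Finite.of_basis c
  set t := Algebra.traceMatrix S c k l with ht
  have hrepr : t * b j = ∑ m, Algebra.leftMulMatrix b t m j • b m := by
    simp only [Algebra.leftMulMatrix_eq_repr_mul]
    exact (b.sum_repr _).symm
  have htrace : Algebra.trace S T (b i • c k * b j • c l) =
      ∑ m, Algebra.leftMulMatrix b t m j • (b i * b m) := by
    rw [smul_mul_smul_comm, map_smul, smul_eq_mul, mul_assoc, mul_comm (b j),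
      ← Algebra.traceForm_apply, ← Algebra.traceMatrix_apply, ← ht, hrepr, Finset.mul_sum]
    exact Finset.sum_congr rfl fun m _ => mul_smul_comm _ _ _
  rw [← Algebra.trace_trace (S := S), htrace, map_sum]
  refine Finset.sum_congr rfl fun m _ => ?_
  rw [map_smul, smul_eq_mul, mul_comm, Algebra.traceMatrix_apply, Algebra.traceForm_apply]

variable [Fintype κ] [DecidableEq κ]

theorem traceMatrix_smulTower' :
    Algebra.traceMatrix R (b.smulTower' c) = ((1 : Matrix κ κ R) ⊗ₖ Algebra.traceMatrix R b) *
      ((Algebra.traceMatrix S c).map (Algebra.leftMulMatrix b)).comp _ _ _ _ _ := by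
  ext ⟨k, i⟩ ⟨l, j⟩
  rw [Matrix.mul_apply, Fintype.sum_prod_type, Finset.sum_eq_single k]
  · simp only [kroneckerMap_apply, one_apply_eq, one_mul, comp_apply, map_apply]
    rw [← trace_smul_mul_smul b c, Algebra.traceMatrix_apply, Algebra.traceForm_apply,
      Module.Basis.smulTower'_apply, Module.Basis.smulTower'_apply]
  · intro k' _ hk
    exact Finset.sum_eq_zero fun m _ => by simp [kroneckerMap_apply, one_apply_ne hk.symm]
  · simp

theorem discr_smulTower' : Algebra.discr R (b.smulTower' c) =
    Algebra.discr R b ^ Fintype.card κ * Algebra.norm R (Algebra.discr S c) := by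
  rw [Algebra.discr_def, traceMatrix_smulTower', det_mul, det_kronecker, det_one, one_pow,
    one_mul, Algebra.discr_def, Algebra.norm_eq_matrix_det b, Algebra.discr_def]
  congr 1
  exact (Matrix.det_det (M := Algebra.traceMatrix S c)
    (Algebra.leftMulMatrix b : S →+* Matrix ι ι R)).symm

end DiscrTower

section Norm

variable {F Ω : Type*} [Field F] [Field Ω] [Algebra F Ω] {N : AbsoluteValue Ω ℝ}
  {E : IntermediateField F Ω}

theorem map_embedding_eq [Normal F Ω] (hN : ∀ (σ : Ω ≃ₐ[F] Ω) (x : Ω), N (σ x) = N x)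
    (f : E →ₐ[F] Ω) (x : E) : N (f x) = N x := by
  rw [← hN (AlgEquiv.ofBijective _ (AlgHom.normal_bijective F Ω Ω (f.liftNormal Ω))) x]
  exact congrArg N (f.liftNormal_commutes Ω x).symm

theorem restrictAbs_norm [IsGalois F Ω] [IsAlgClosed Ω]
    (hN : ∀ (σ : Ω ≃ₐ[F] Ω) (x : Ω), N (σ x) = N x) [FiniteDimensional F E] (x : E) :
    restrictAbs F N (Algebra.norm F x) = N x ^ Module.finrank F E := by
  rw [restrictAbs_apply, Algebra.norm_eq_prod_embeddings F Ω, map_prod,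
    Finset.prod_congr rfl (fun f _ => map_embedding_eq hN f x), Finset.prod_const,
    Finset.card_univ, AlgHom.card]

end Norm

section QuadraticDiscr

variable {F Ω : Type*} [Field F] [Field Ω] [Algebra F Ω] {E : IntermediateField F Ω}
  (hE : Module.finrank F E = 2) {w : E} (hwF : (w : Ω) ∉ Set.range (algebraMap F Ω)) {a b : F}
  (hw : (w : Ω) ^ 2 + algebraMap F Ω a * w + algebraMap F Ω b = 0)

include hw in
theorem mul_self_eq_smul_add_smul : w * w = (-b) • (1 : E) + (-a) • w := by
  apply Subtype.ext
  have : (w : Ω) * w = -algebraMap F Ω b * 1 + -algebraMap F Ω a * w := by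
    linear_combination hw
  simpa [Algebra.smul_def] using this

include hE hwF hw

theorem trace_eq_neg_of_quadratic : Algebra.trace F E w = -a := by
  have hB := coe_pairBasis hE hwF
  generalize pairBasis hE hwF = B at hB
  have hB0 : B 0 = 1 := congrFun hB 0
  have hB1 : B 1 = w := congrFun hB 1
  have h00 : B.repr (w * B 0) 0 = 0 := by
    rw [hB0, mul_one, ← hB1, Module.Basis.repr_self]
    simp
  have h11 : B.repr (w * B 1) 1 = -a := by
    rw [hB1, mul_self_eq_smul_add_smul hw, ← hB0, ← hB1, map_add, map_smul, map_smul,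
      Module.Basis.repr_self, Module.Basis.repr_self]
    simp
  rw [Algebra.trace_eq_matrix_trace B, Matrix.trace_fin_two, Algebra.leftMulMatrix_eq_repr_mul,
    Algebra.leftMulMatrix_eq_repr_mul, h00, h11, zero_add]

theorem discr_pairBasis : Algebra.discr F (pairBasis hE hwF) = a ^ 2 - 4 * b := by
  have hone : Algebra.trace F E 1 = 2 := by
    rw [← map_one (algebraMap F E), Algebra.trace_algebraMap, hE, nsmul_one, Nat.cast_ofNat]
  have hw1 := trace_eq_neg_of_quadratic hE hwF hw
  have hw2 : Algebra.trace F E (w * w) = a ^ 2 - 2 * b := by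
    rw [mul_self_eq_smul_add_smul hw, map_add, map_smul, map_smul, hone, hw1, smul_eq_mul,
      smul_eq_mul]
    ring
  rw [Algebra.discr_def, Matrix.det_fin_two]
  simp only [Algebra.traceMatrix_apply, Algebra.traceForm_apply, coe_pairBasis,
    Matrix.cons_val_zero, Matrix.cons_val_one, one_mul, mul_one, hone, hw1, hw2]
  ring

end QuadraticDiscr

section IntegralDiscr

variable {K L ι : Type*} [Field K] [Algebra ℤ_[2] K] [Field L] [Algebra K L] [Fintype ι]
  [DecidableEq ι]

theorem discr_comp_equiv {R S κ : Type*} [CommRing R] [CommRing S] [Algebra R S] [Fintype κ]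
    [DecidableEq κ] (r : κ ≃ ι) (b : ι → S) : Algebra.discr R (b ∘ r) = Algebra.discr R b :=
  Matrix.det_submatrix_equiv_self r (Algebra.traceMatrix R b)

theorem discr_mem_span_of_repr_mem (B : Module.Basis ι K L) {b : ι → integersOver K L}
    (hb : ∀ i, (b i : L) = B i) (hrepr : ∀ x ∈ integersOver K L, ∀ i, B.repr x i ∈ integers K)
    (c : ι → integersOver K L) :
    Algebra.discr (integers K) c ∈ Ideal.span {Algebra.discr (integers K) b} := by
  let P : Matrix ι ι (integers K) := Matrix.of fun i j => ⟨B.repr (c j) i, hrepr _ (c j).2 i⟩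
  have hP : c = Matrix.vecMul b (P.map (algebraMap (integers K) (integersOver K L))) := by
    ext j
    refine (B.sum_repr (c j)).symm.trans ?_
    simp only [Matrix.vecMul, dotProduct, Matrix.map_apply, AddSubmonoidClass.coe_finsetSum,
      MulMemClass.coe_mul, hb]
    refine Finset.sum_congr rfl fun i _ => ?_
    rw [Algebra.smul_def, mul_comm]
    rfl
  rw [hP, Algebra.discr_of_matrix_vecMul]
  exact Ideal.mul_mem_left _ _ (Ideal.mem_span_singleton_self _)

theorem discrIdeal_eq_span (B : Module.Basis ι K L) {b : ι → integersOver K L}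
    (hb : ∀ i, (b i : L) = B i) (hrepr : ∀ x ∈ integersOver K L, ∀ i, B.repr x i ∈ integers K) :
    discrIdeal K L = Ideal.span {Algebra.discr (integers K) b} := by
  let r : Fin (Module.finrank K L) ≃ ι :=
    (finCongr (Module.finrank_eq_card_basis B)).trans (Fintype.equivFin ι).symm
  refine le_antisymm (Ideal.span_le.2 ?_) ?_
  · rintro _ ⟨c, rfl⟩
    change Algebra.discr (integers K) c ∈ _
    rw [← discr_comp_equiv r.symm]
    exact discr_mem_span_of_repr_mem B hb hrepr _
  · rw [Ideal.span_singleton_le_iff_mem]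
    exact Ideal.subset_span ⟨b ∘ r, discr_comp_equiv r b⟩

variable [Algebra ℚ_[2] K] [FiniteDimensional ℚ_[2] K] [IsScalarTower ℤ_[2] ℚ_[2] K]

theorem algebraMap_discr [FiniteDimensional K L] (b : ι → integersOver K L) :
    algebraMap (integers K) K (Algebra.discr (integers K) b) =
      Algebra.discr K fun i => (b i : L) := by
  have : Module.IsTorsionFree (integers K) L := .trans_faithfulSMul _ K L
  have := IsIntegralClosure.finite (integers K) K L (integersOver K L)
  have := IsIntegralClosure.module_free (integers K) K L (integersOver K L)
  have := IsIntegralClosure.isLocalization (integers K) K L (integersOver K L)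
  rw [Algebra.discr_def, Algebra.discr_def, RingHom.map_det]
  congr 1
  ext i j
  simp only [RingHom.mapMatrix_apply, Matrix.map_apply, Algebra.traceMatrix_apply,
    Algebra.traceForm_apply]
  exact (Algebra.trace_localization (Rₘ := K) (Sₘ := L) (integers K)
    (nonZeroDivisors (integers K)) (b i * b j)).symm

theorem baseAbs_discr (B : Module.Basis ι K L) (hB : ∀ i, B i ∈ integersOver K L)
    (hrepr : ∀ x ∈ integersOver K L, ∀ i, B.repr x i ∈ integers K) {ϖ : integers K}
    (hϖ : Irreducible ϖ) : baseAbs K (Algebra.discr K B) = baseAbs K ϖ ^ discrVal K L := by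
  have : FiniteDimensional K L := .of_basis B
  let b : ι → integersOver K L := fun i => ⟨B i, hB i⟩
  have hdiscr : (Algebra.discr (integers K) b : K) = Algebra.discr K B := algebraMap_discr b
  rw [discrVal, discrIdeal_eq_span B (b := b) (fun _ => rfl) hrepr, ← hdiscr]
  refine baseAbs_eq_pow_multiplicity hϖ fun h0 => Algebra.discr_not_zero_of_basis K B ?_
  rw [← hdiscr, h0, ZeroMemClass.coe_zero]

end IntegralDiscr

section Ramification

open IsLocalRing

theorem ramificationIdx_le_finrank (R : Type*) {S : Type*} [CommRing R] [IsDomain R] [CommRing S]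
    [Algebra R S] [Module.Finite R S] [Module.Flat R S] (P : Ideal S) [P.IsPrime] :
    P.ramificationIdx R ≤ Module.finrank R S := by
  let primes := (P.under R).primesOver S
  have : Fintype primes := (Algebra.QuasiFinite.finite_primesOver (S := S) (P.under R)).fintype
  let P' : primes := ⟨P, inferInstance, inferInstance⟩
  calc P.ramificationIdx R ≤ P'.1.ramificationIdx R * P'.1.inertiaDeg R :=
        Nat.le_mul_of_pos_right _ (P.inertiaDeg_pos R)
    _ ≤ ∑ Q : primes, Q.1.ramificationIdx R * Q.1.inertiaDeg R :=
        Finset.single_le_sum (f := fun Q : primes => Q.1.ramificationIdx R * Q.1.inertiaDeg R)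
          (fun _ _ => Nat.zero_le _) (Finset.mem_univ P')
    _ = Module.finrank R S := Ideal.sum_ramification_inertia_eq_finrank (P.under R) S

variable (K : Type*) [Field K] [Algebra ℚ_[2] K] [FiniteDimensional ℚ_[2] K]
  [Algebra ℤ_[2] K] [IsScalarTower ℤ_[2] ℚ_[2] K] (L : IntermediateField K (AlgebraicClosure K))

/-- The absolute value on the integers of an extension of `K`, as a monoid homomorphism. -/
noncomputable def integersOverAbs : integersOver K L →* ℝ :=
  (restrictAbs L (closureAbs K) : L →* ℝ).comp
    (algebraMap (integersOver K L) L : integersOver K L →* L)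

variable {L} in
theorem integersOverAbs_of_isUnit (x : integersOver K L) (hx : IsUnit x) :
    integersOverAbs K L x = 1 :=
  (isUnit_integersOver_iff x).1 hx

variable [FiniteDimensional K L]

instance isDedekindDomain_integersOver : IsDedekindDomain (integersOver K L) :=
  integralClosure.isDedekindDomain (integers K) K L

instance isDiscreteValuationRing_integersOver : IsDiscreteValuationRing (integersOver K L) where
  not_a_field' hbot := by
    have hmem : (2 : integersOver K L) ∈ maximalIdeal (integersOver K L) := by
      rw [mem_maximalIdeal, mem_nonunits_iff, isUnit_integersOver_iff]
      have htwo := baseAbs_two_lt_one K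
      rw [restrictAbs_apply, map_ofNat] at htwo
      exact htwo.ne
    rw [hbot, Ideal.mem_bot] at hmem
    exact two_ne_zero (α := L) (congrArg Subtype.val hmem)

theorem ramificationIdx_integersOver_le_finrank (P : Ideal (integersOver K L)) [P.IsPrime] :
    P.ramificationIdx (integers K) ≤ Module.finrank K L := by
  have : Module.IsTorsionFree (integers K) L := .trans_faithfulSMul _ K L
  have := IsIntegralClosure.finite (integers K) K L (integersOver K L)
  have := IsIntegralClosure.module_free (integers K) K L (integersOver K L)
  exact (ramificationIdx_le_finrank (integers K) P).trans_eq
    (IsIntegralClosure.rank (integers K) K L (integersOver K L))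

variable {K L} {ϖ : integers K} (hϖ : Irreducible ϖ)

theorem exists_closureAbs_eq_pow {p : integersOver K L} (hp : Irreducible p) {x : L} (hx : x ≠ 0)
    (hx1 : closureAbs K x ≤ 1) : ∃ n : ℕ, closureAbs K x = closureAbs K (p : L) ^ n :=
  ⟨_, map_eq_pow_multiplicity (integersOverAbs_of_isUnit K) hp
    (x := ⟨x, (mem_integersOver_iff L x).2 hx1⟩) fun h => hx (congrArg Subtype.val h)⟩

include hϖ

theorem baseAbs_eq_pow_ramificationIdx {p : integersOver K L} (hp : Irreducible p) :
    baseAbs K ϖ = closureAbs K (p : L) ^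
      (maximalIdeal (integersOver K L)).ramificationIdx (integers K) := by
  have hne : algebraMap (integers K) (integersOver K L) ϖ ≠ 0 := fun h => by
    have hval : algebraMap K L ϖ = 0 := congrArg Subtype.val h
    exact hϖ.ne_zero (Subtype.ext ((map_eq_zero _).1 hval))
  have hmap := map_algebraMap_eq_pow_ramificationIdx (ν := integersOverAbs K L)
    (integersOverAbs_of_isUnit K) hp ((IsDiscreteValuationRing.irreducible_iff_uniformizer ϖ).1 hϖ)
    hne
  exact hmap

theorem isTotallyRamified_iff_exists_pow : IsTotallyRamified K L ↔
    ∃ w ∈ L, closureAbs K w ^ Module.finrank K L = baseAbs K ϖ := by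
  obtain ⟨p, hp⟩ := IsDiscreteValuationRing.exists_irreducible (integersOver K L)
  have hpr := baseAbs_eq_pow_ramificationIdx hϖ hp
  refine ⟨fun hL => ⟨p, (p : L).2, ?_⟩, fun ⟨w, hwL, hw⟩ P hP => ?_⟩
  · rw [hpr, hL _ (maximalIdeal.isMaximal _)]
  obtain rfl := eq_maximalIdeal hP
  set r := (maximalIdeal (integersOver K L)).ramificationIdx (integers K)
  have hn : Module.finrank K L ≠ 0 := Module.finrank_pos.ne'
  have hw1 : closureAbs K w < 1 :=
    (pow_lt_one_iff_of_nonneg ((closureAbs K).nonneg w) hn).1 (hw ▸ baseAbs_lt_one hϖ)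
  have hw0 : w ≠ 0 := by
    rintro rfl
    rw [map_zero, zero_pow hn] at hw
    exact (baseAbs_pos hϖ).ne hw
  obtain ⟨k, hk⟩ := exists_closureAbs_eq_pow hp (x := ⟨w, hwL⟩)
    (fun h => hw0 (congrArg Subtype.val h)) hw1.le
  change closureAbs K w = _ at hk
  have hp0 : 0 < closureAbs K (p : L) :=
    (closureAbs K).pos fun h => hp.ne_zero (Subtype.ext (Subtype.ext h))
  have hp1 : closureAbs K (p : L) ≠ 1 := fun h => by simp [hk, h] at hw1
  have hr : k * Module.finrank K L = r := by
    refine pow_right_injective₀ hp0 hp1 ?_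
    dsimp only
    rw [pow_mul, ← hk, hw, hpr]
  have hk0 : k ≠ 0 := by
    rintro rfl
    simp [hk] at hw1
  exact (ramificationIdx_integersOver_le_finrank K L _).antisymm
    ((Nat.le_mul_of_pos_left _ hk0.bot_lt).trans_eq hr)

end Ramification

section Tower

variable {F Ω : Type*} [Field F] [Field Ω] [Algebra F Ω] {N : AbsoluteValue Ω ℝ} {ρ : ℝ} {w : Ω}

theorem map_constantCoeff_of_quadratic [IsGalois F Ω]
    (hN : ∀ (σ : Ω ≃ₐ[F] Ω) (x : Ω), N (σ x) = N x) {a b : F}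
    (hw : w ^ 2 + algebraMap F Ω a * w + algebraMap F Ω b = 0)
    (hwF : w ∉ Set.range (algebraMap F Ω)) : N (algebraMap F Ω b) = N w ^ 2 := by
  obtain ⟨σ, hσ⟩ := exists_algEquiv_eq_neg_sub hw hwF
  have hb : algebraMap F Ω b = w * σ w := by
    rw [hσ]
    linear_combination hw
  rw [hb, map_mul, hN, sq]

theorem sqrt_eq_of_sq (hw : N w ^ 2 = ρ) : √ρ = N w := by
  rw [← hw, Real.sqrt_sq (N.nonneg w)]

theorem finrank_restrictScalars_of_mem_ramQuadratics {E : IntermediateField F Ω}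
    (hE : E ∈ ramQuadratics F N ρ) {ρ' : ℝ} {M : IntermediateField E Ω}
    (hM : M ∈ ramQuadratics E N ρ') : Module.finrank F (M.restrictScalars F) = 4 := by
  have hmul := Module.finrank_mul_finrank F E M
  rw [hE.1, hM.1] at hmul
  exact hmul.symm

namespace IsDyadicBase

variable {q e : ℕ} (H : IsDyadicBase F N ρ q e)
include H

theorem extend_of_mem_ramQuadratics [IsGalois F Ω] [IsAlgClosed Ω] {E : IntermediateField F Ω}
    (hE : E ∈ ramQuadratics F N ρ) : IsDyadicBase E N √ρ q (2 * e) := by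
  obtain ⟨hE2, w, hwE, hw⟩ := hE
  rw [sqrt_eq_of_sq hw]
  exact H.extend hE2 hwE hw

theorem mem_ramQuadratics_of_le [IsGalois F Ω] {L E : IntermediateField F Ω}
    (hL : Module.finrank F L = 4) (hwL : w ∈ L) (hw : N w ^ 4 = ρ) (hEL : E ≤ L)
    (hE : Module.finrank F E = 2) : E ∈ ramQuadratics F N ρ ∧
      IntermediateField.extendScalars hEL ∈ ramQuadratics E N √ρ := by
  have hfin : Module.finrank E (IntermediateField.extendScalars hEL) = 2 := by
    have hmul := Module.finrank_mul_finrank F E (IntermediateField.extendScalars hEL)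
    have hL' : Module.finrank F (IntermediateField.extendScalars hEL) = 4 := hL
    rw [hE, hL'] at hmul
    lia
  have hwF : w ∉ Set.range (algebraMap F Ω) := by
    rintro ⟨c, rfl⟩
    refine H.notMem_range_of_sq (x := algebraMap F Ω (c ^ 2)) ?_ ⟨c ^ 2, rfl⟩
    rw [← hw, map_pow, map_pow, ← pow_mul]
  have hwE : w ∉ Set.range (algebraMap E Ω) := by
    rintro ⟨c, rfl⟩
    obtain ⟨a, b, hab⟩ := exists_quadratic_of_finrank_eq_two hE c.2 hwF
    refine H.notMem_range_of_sq (x := algebraMap F Ω b) ?_ ⟨b, rfl⟩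
    rw [map_constantCoeff_of_quadratic H.map_algEquiv hab hwF, ← hw, ← pow_mul]
    rfl
  have hwM := (IntermediateField.mem_extendScalars hEL).2 hwL
  obtain ⟨a, b, hab⟩ := exists_quadratic_of_finrank_eq_two hfin hwM hwE
  have hb : N b = N w ^ 2 := map_constantCoeff_of_quadratic (F := E)
    (fun σ x => H.map_algEquiv (σ.restrictScalars F) x) hab hwE
  have hb2 : N b ^ 2 = ρ := by rw [hb, ← hw, ← pow_mul]
  exact ⟨⟨hE, b, b.2, hb2⟩, hfin, w, hwM, by rw [sqrt_eq_of_sq hb2, hb]⟩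

theorem exists_pow_four_eq {E : IntermediateField F Ω} {M : IntermediateField E Ω}
    (hM : M ∈ ramQuadratics E N √ρ) : ∃ w ∈ M.restrictScalars F, N w ^ 4 = ρ := by
  obtain ⟨-, w, hwM, hw⟩ := hM
  refine ⟨w, hwM, ?_⟩
  rw [← Real.sq_sqrt H.dyadic.pos.le, ← hw, ← pow_mul]

theorem le_one_and_le_one_of_map_add_mul_le_one (hw : N w ^ 2 = ρ) {a b : F}
    (h : N (algebraMap F Ω a + algebraMap F Ω b * w) ≤ 1) :
    restrictAbs F N a ≤ 1 ∧ restrictAbs F N b ≤ 1 := by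
  rw [H.map_add_mul hw, max_le_iff] at h
  refine ⟨h.1, ?_⟩
  obtain rfl | hb := eq_or_ne b 0
  · simp
  obtain ⟨n, hn⟩ := H.dyadic.exists_zpow b hb
  have hlt := H.mul_lt_one_of_le hw h.2
  rw [hn] at hlt ⊢
  have hsq : ρ ^ (2 * n + 1) < ρ ^ (0 : ℤ) := by
    rw [zpow_zero, zpow_add_one₀ H.dyadic.pos.ne', mul_comm 2 n, zpow_mul, ← hw, zpow_ofNat,
      ← mul_pow, hw]
    exact pow_lt_one₀ (mul_nonneg (zpow_nonneg H.dyadic.pos.le n) (N.nonneg w)) hlt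
      _root_.two_ne_zero
  have hn0 : 0 < 2 * n + 1 := H.dyadic.zpow_lt_zpow_iff.1 hsq
  rw [← zpow_zero ρ, H.dyadic.zpow_le_zpow_iff]
  lia

end IsDyadicBase

end Tower

section IntegralBasis

variable {F Ω : Type*} [Field F] [Field Ω] [Algebra F Ω] {N : AbsoluteValue Ω ℝ} {ρ : ℝ} {q e : ℕ}
  {E : IntermediateField F Ω}

namespace IsDyadicBase

variable (H : IsDyadicBase F N ρ q e)
include H

theorem map_pairBasis_le_one (hE : Module.finrank F E = 2) {w : E}
    (hwF : (w : Ω) ∉ Set.range (algebraMap F Ω)) (hw : N w ^ 2 = ρ) (i : Fin 2) :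
    N (pairBasis hE hwF i) ≤ 1 := by
  have hw1 : N w ≤ 1 := by
    by_contra! hgt
    exact ((one_lt_pow₀ hgt _root_.two_ne_zero).trans_eq hw).not_gt H.dyadic.lt_one
  rw [coe_pairBasis]
  fin_cases i
  · exact (map_one N).le
  · exact hw1

theorem repr_pairBasis_le_one (hE : Module.finrank F E = 2) {w : E}
    (hwF : (w : Ω) ∉ Set.range (algebraMap F Ω)) (hw : N w ^ 2 = ρ) {x : E} (hx : N x ≤ 1)
    (i : Fin 2) : restrictAbs F N ((pairBasis hE hwF).repr x i) ≤ 1 := by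
  rw [coe_eq_repr_pairBasis hE hwF] at hx
  have hrepr := H.le_one_and_le_one_of_map_add_mul_le_one hw hx
  fin_cases i
  exacts [hrepr.1, hrepr.2]

theorem restrictAbs_discr_smulTower' [IsGalois F Ω] [IsAlgClosed Ω] (hE : Module.finrank F E = 2)
    {ι κ : Type*} [Fintype ι] [DecidableEq ι] [Fintype κ] [DecidableEq κ] {T : Type*} [Field T]
    [Algebra F T] [Algebra E T] [IsScalarTower F E T] (B : Module.Basis ι F E)
    (C : Module.Basis κ E T) {d d' : ℕ} (hκ : Fintype.card κ = 2)
    (hB : restrictAbs F N (Algebra.discr F B) = ρ ^ d)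
    (hC : restrictAbs E N (Algebra.discr E C) = √ρ ^ d') :
    restrictAbs F N (Algebra.discr F (B.smulTower' C)) = ρ ^ (2 * d + d') := by
  have : FiniteDimensional F E := .of_basis B
  have hC' : N (Algebra.discr E C : Ω) = √ρ ^ d' := hC
  rw [discr_smulTower', map_mul, map_pow, hB, restrictAbs_norm H.map_algEquiv, hC', hκ, hE,
    ← pow_mul, ← pow_mul, mul_comm d' 2, pow_mul √ρ, Real.sq_sqrt H.dyadic.pos.le, pow_add,
    mul_comm d 2]

end IsDyadicBase

end IntegralBasis

section DiscrVal

open IntermediateField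

variable {K : Type*} [Field K] [Algebra ℚ_[2] K] [FiniteDimensional ℚ_[2] K]
  [Algebra ℤ_[2] K] [IsScalarTower ℤ_[2] ℚ_[2] K] {ϖ : integers K}
  {E : IntermediateField K (AlgebraicClosure K)} {M : IntermediateField E (AlgebraicClosure K)}

theorem mem_integersOver_tower_iff (x : M) : x ∈ integersOver K M ↔ closureAbs K x ≤ 1 :=
  mem_integersOver_iff (M.restrictScalars K) x

theorem smulTower'_mem_integersOver {ι κ : Type*} {B : Module.Basis ι K E}
    {C : Module.Basis κ E M} (hB : ∀ i, closureAbs K (B i) ≤ 1) (hC : ∀ j, closureAbs K (C j) ≤ 1)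
    (p : κ × ι) : B.smulTower' C p ∈ integersOver K M := by
  have hcoe : ((B.smulTower' C p : M) : AlgebraicClosure K) = B p.2 * C p.1 := by
    rw [Module.Basis.smulTower'_apply, Algebra.smul_def]
    rfl
  rw [mem_integersOver_tower_iff, hcoe, map_mul]
  exact mul_le_one₀ (hB _) ((closureAbs K).nonneg _) (hC _)

theorem repr_smulTower'_mem_integers {ι κ : Type*} {B : Module.Basis ι K E}
    {C : Module.Basis κ E M}
    (hB : ∀ y : E, closureAbs K y ≤ 1 → ∀ i, baseAbs K (B.repr y i) ≤ 1)
    (hC : ∀ x : M, closureAbs K x ≤ 1 → ∀ j, restrictAbs E (closureAbs K) (C.repr x j) ≤ 1)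
    (x : M) (hx : x ∈ integersOver K M) (p : κ × ι) :
    (B.smulTower' C).repr x p ∈ integers K := by
  rw [Module.Basis.smulTower'_repr, mem_integers_iff]
  exact hB _ (hC x ((mem_integersOver_tower_iff x).1 hx) p.1) p.2

theorem discrVal_tower (hϖ : Irreducible ϖ) {d d' : ℕ}
    (hE : E ∈ ramQuadratics K (closureAbs K) (baseAbs K ϖ))
    (hd : HasDisc (closureAbs K) (baseAbs K ϖ) E d)
    (hM : M ∈ ramQuadratics E (closureAbs K) √(baseAbs K ϖ))
    (hd' : HasDisc (closureAbs K) √(baseAbs K ϖ) M d') :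
    discrVal K (M.restrictScalars K) = 2 * d + d' := by
  have H := isDyadicBase hϖ
  have HE := H.extend_of_mem_ramQuadratics hE
  obtain ⟨w, hwE, hw, a, b, hab, hdab⟩ := hd
  obtain ⟨w', hwM, hw', a', b', hab', hdab'⟩ := hd'
  lift w to E using hwE
  lift w' to M using hwM
  have hwK := H.notMem_range_of_sq hw
  have hwE' := HE.notMem_range_of_sq hw'
  let B := pairBasis hE.1 hwK
  let C := pairBasis hM.1 hwE'
  have hdiscr := H.restrictAbs_discr_smulTower' hE.1 B C (Fintype.card_fin 2)
    (by rw [discr_pairBasis hE.1 hwK hab, hdab]) (by rw [discr_pairBasis hM.1 hwE' hab', hdab'])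
  have hpow : baseAbs K (Algebra.discr K (B.smulTower' C)) = baseAbs K ϖ ^ discrVal K M := by
    exact baseAbs_discr (B.smulTower' C) (smulTower'_mem_integersOver
      (H.map_pairBasis_le_one hE.1 hwK hw) (HE.map_pairBasis_le_one hM.1 hwE' hw'))
      (repr_smulTower'_mem_integers (fun _ => H.repr_pairBasis_le_one hE.1 hwK hw)
        fun _ => HE.repr_pairBasis_le_one hM.1 hwE' hw') hϖ
  exact pow_right_injective₀ H.dyadic.pos H.dyadic.lt_one.ne (hpow.symm.trans hdiscr)

end DiscrVal

/-! ### Mass and towers -/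

section Conjugates

variable {K Ω : Type*} [Field K] [Field Ω] [Algebra K Ω]

theorem fieldRange_val_comp_algEquiv {L L' : IntermediateField K Ω} (g : L ≃ₐ[K] L') :
    (L'.val.comp (g : L →ₐ[K] L')).fieldRange = L' := by
  ext x
  exact ⟨fun ⟨y, hy⟩ => hy ▸ (g y).2, fun hx => ⟨g.symm ⟨x, hx⟩, by simp⟩⟩

-- Orbit–stabiliser for `Aut(L/K)` acting on the embeddings of `L`, whose images are the conjugates.
theorem card_conjugates_mul_card_aut [IsAlgClosed Ω] (L : IntermediateField K Ω)
    [FiniteDimensional K L] [Algebra.IsSeparable K L] :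
    Nat.card {L' : IntermediateField K Ω // Nonempty (L ≃ₐ[K] L')} * Nat.card (L ≃ₐ[K] L) =
      Module.finrank K L := by
  rw [← Nat.card_prod, ← AlgHom.card K L Ω, ← Nat.card_eq_fintype_card]
  refine Nat.card_congr (Equiv.ofBijective
    (fun p => p.1.1.val.comp ((p.2.trans p.1.2.some : L ≃ₐ[K] p.1.1) : L →ₐ[K] p.1.1)) ⟨?_, ?_⟩)
  · rintro ⟨⟨L', hL'⟩, σ⟩ ⟨⟨L'', hL''⟩, τ⟩ heq
    obtain rfl : L' = L'' := by
      rw [← fieldRange_val_comp_algEquiv (σ.trans hL'.some),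
        ← fieldRange_val_comp_algEquiv (τ.trans hL''.some)]
      exact congrArg AlgHom.fieldRange heq
    obtain rfl : σ = τ := AlgEquiv.ext fun x =>
      hL'.some.injective (Subtype.ext (DFunLike.congr_fun heq x))
    rfl
  · intro f
    let g : L ≃ₐ[K] f.fieldRange := AlgEquiv.ofInjectiveField f
    have hg : Nonempty (L ≃ₐ[K] f.fieldRange) := ⟨g⟩
    refine ⟨⟨⟨f.fieldRange, hg⟩, g.trans hg.some.symm⟩, AlgHom.ext fun x => ?_⟩
    exact congrArg Subtype.val (hg.some.apply_symm_apply (g x))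

end Conjugates

section Mass

variable {K : Type*} [Field K] [Algebra ℚ_[2] K] [FiniteDimensional ℚ_[2] K]
  [Algebra ℤ_[2] K] [IsScalarTower ℤ_[2] ℚ_[2] K]

theorem weight_eq_card_conjugates_mul (L : IntermediateField K (AlgebraicClosure K))
    [FiniteDimensional K L] : weight K L = (Module.finrank K L : ℝ)⁻¹ *
      (Nat.card {L' : IntermediateField K (AlgebraicClosure K) // Nonempty (L ≃ₐ[K] L')} *
        ((residueCard K : ℝ) ^ discrVal K L)⁻¹) := by
  have hcard := card_conjugates_mul_card_aut L
  have hpos : 0 < Nat.card {L' : IntermediateField K (AlgebraicClosure K) //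
      Nonempty (L ≃ₐ[K] L')} :=
    Nat.pos_of_mul_pos_right (hcard ▸ Module.finrank_pos)
  rw [weight, ← hcard, Nat.cast_mul, mul_inv, div_eq_mul_inv]
  field_simp

theorem mass_image {n : ℕ} (hn : n ≠ 0) {S : Set (IntermediateField K (AlgebraicClosure K))}
    (hS : S.Finite) (hdeg : ∀ L ∈ S, Module.finrank K L = n)
    (hconj : ∀ L ∈ S, ∀ L' : IntermediateField K (AlgebraicClosure K),
      Nonempty (L ≃ₐ[K] L') → L' ∈ S) :
    mass K (Quotient.mk (extensionSetoid K) '' S) =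
      (n : ℝ)⁻¹ * ∑ᶠ L ∈ S, ((residueCard K : ℝ) ^ discrVal K L)⁻¹ := by
  classical
  have hfin := hS.image (Quotient.mk (extensionSetoid K))
  rw [mass, finsum_mem_eq_finite_toFinset_sum _ hfin, finsum_mem_eq_finite_toFinset_sum _ hS,
    Finset.mul_sum, ← Finset.sum_fiberwise_of_maps_to (s := hS.toFinset) (t := hfin.toFinset)
      (g := Quotient.mk (extensionSetoid K))
      (fun L hL => hfin.mem_toFinset.2 ⟨L, hS.mem_toFinset.1 hL, rfl⟩)]
  refine Finset.sum_congr rfl fun c hc => ?_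
  obtain ⟨L, hL, rfl⟩ := hfin.mem_toFinset.1 hc
  have : FiniteDimensional K L := Module.finite_of_finrank_pos (by rw [hdeg L hL]; lia)
  have hfibre : (hS.toFinset.filter fun L' => (Quotient.mk (extensionSetoid K) L') =
      Quotient.mk (extensionSetoid K) L).card =
      Nat.card {L' : IntermediateField K (AlgebraicClosure K) // Nonempty (L ≃ₐ[K] L')} := by
    refine (Nat.subtype_card _ fun L' => ?_).symm
    rw [Finset.mem_filter, Set.Finite.mem_toFinset]
    exact ⟨fun h => Quotient.exact h.2.symm, fun h => ⟨hconj L hL L' h, (Quotient.sound h).symm⟩⟩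
  have hconst : ∀ L' ∈ hS.toFinset.filter fun L' => (Quotient.mk (extensionSetoid K) L') =
      Quotient.mk (extensionSetoid K) L,
      (n : ℝ)⁻¹ * ((residueCard K : ℝ) ^ discrVal K L')⁻¹ =
        (n : ℝ)⁻¹ * ((residueCard K : ℝ) ^ discrVal K L)⁻¹ := fun L' hL' => by
    obtain ⟨f⟩ := Quotient.exact (Finset.mem_filter.1 hL').2
    rw [discrVal, discrIdeal_congr f, discrVal]
  rw [Finset.sum_congr rfl hconst, Finset.sum_const, hfibre, nsmul_eq_mul]
  refine (weight_eq_card_conjugates_mul L).trans ?_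
  rw [hdeg L hL, mul_left_comm]

end Mass

theorem finsum_mem_ncard_mul_comm {α β R : Type*} [Semiring R] {s : Set α} {t : Set β}
    (hs : s.Finite) (ht : t.Finite) {u : α → Set β} {v : β → Set α}
    (h : ∀ a b, (b ∈ t ∧ a ∈ v b) ↔ (a ∈ s ∧ b ∈ u a)) (φ : β → R) :
    ∑ᶠ b ∈ t, ((v b).ncard : R) * φ b = ∑ᶠ a ∈ s, ∑ᶠ b ∈ u a, φ b := by
  classical
  have hu (a : α) (ha : a ∈ s) : u a = (ht.toFinset.filter (· ∈ u a) : Finset β) := by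
    ext b
    simpa using fun hb => ((h a b).2 ⟨ha, hb⟩).1
  have hv (b : β) (hb : b ∈ t) : v b = (hs.toFinset.filter (· ∈ v b) : Finset α) := by
    ext a
    simpa using fun ha => ((h a b).1 ⟨hb, ha⟩).1
  calc ∑ᶠ b ∈ t, ((v b).ncard : R) * φ b
      = ∑ b ∈ ht.toFinset, ∑ _a ∈ hs.toFinset with _a ∈ v b, φ b := by
        rw [finsum_mem_eq_finite_toFinset_sum _ ht]
        refine Finset.sum_congr rfl fun b hb => ?_
        rw [Finset.sum_const, nsmul_eq_mul, ← Set.ncard_coe_finset, ← hv b (ht.mem_toFinset.1 hb)]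
    _ = ∑ a ∈ hs.toFinset, ∑ b ∈ ht.toFinset with b ∈ u a, φ b :=
        Finset.sum_comm' fun b a => by
          have := h a b
          simp only [Finset.mem_filter, Set.Finite.mem_toFinset]
          tauto
    _ = ∑ᶠ a ∈ s, ∑ᶠ b ∈ u a, φ b := by
        rw [finsum_mem_eq_finite_toFinset_sum _ hs]
        refine Finset.sum_congr rfl fun a ha => ?_
        conv_rhs => rw [hu a (hs.mem_toFinset.1 ha), finsum_mem_coe_finset]

section Towers

variable (K : Type*) [Field K] [Algebra ℚ_[2] K] [FiniteDimensional ℚ_[2] K]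
  [Algebra ℤ_[2] K] [IsScalarTower ℤ_[2] ℚ_[2] K]

/-- The totally ramified quartic extensions of `K` that have a quadratic subextension. -/
def towerQuartics : Set (IntermediateField K (AlgebraicClosure K)) :=
  {L | Module.finrank K L = 4 ∧ IsTotallyRamified K L ∧ (quadSub L).Nonempty}

variable {K}

theorem mem_towerQuartics_of_algEquiv {L L' : IntermediateField K (AlgebraicClosure K)}
    (f : L ≃ₐ[K] L') (hL : L ∈ towerQuartics K) : L' ∈ towerQuartics K := by
  obtain ⟨hdeg, hram, E, hEL, hE⟩ := hL
  have : FiniteDimensional K L := .of_finrank_pos (by lia)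
  have : FiniteDimensional K L' := f.toLinearEquiv.finiteDimensional
  let φ : L →ₐ[K] AlgebraicClosure K := L'.val.comp f
  refine ⟨f.toLinearEquiv.finrank_eq ▸ hdeg, ?_,
    (IntermediateField.restrict hEL).map φ, fun _ ⟨x, _, hx⟩ => hx ▸ (f x).2, ?_⟩
  · obtain ⟨ϖ, hϖ⟩ := IsDiscreteValuationRing.exists_irreducible (integers K)
    rw [isTotallyRamified_iff_exists_pow hϖ] at hram ⊢
    obtain ⟨w, hwL, hw⟩ := hram
    refine ⟨f ⟨w, hwL⟩, (f ⟨w, hwL⟩).2, ?_⟩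
    rw [← f.toLinearEquiv.finrank_eq, ← hw]
    exact congrArg (· ^ _) (map_embedding_eq (closureAbs_algEquiv K) φ ⟨w, hwL⟩)
  · rw [← (IntermediateField.equivMap _ φ).toLinearEquiv.finrank_eq,
      ← (IntermediateField.restrictAlgEquiv hEL).toLinearEquiv.finrank_eq, hE]

section Uniformizer

variable {ϖ : integers K} (hϖ : Irreducible ϖ) {E L : IntermediateField K (AlgebraicClosure K)}
include hϖ

theorem mem_towerQuartics_and_mem_quadSub_iff : L ∈ towerQuartics K ∧ E ∈ quadSub L ↔
    E ∈ ramQuadratics K (closureAbs K) (baseAbs K ϖ) ∧ L ∈ IntermediateField.restrictScalars K ''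
      ramQuadratics E (closureAbs K) √(baseAbs K ϖ) := by
  have H := isDyadicBase hϖ
  constructor
  · rintro ⟨⟨hL, hram, -⟩, hEL, hE⟩
    have : FiniteDimensional K L := .of_finrank_pos (by lia)
    obtain ⟨w, hwL, hw⟩ := (isTotallyRamified_iff_exists_pow hϖ).1 hram
    obtain ⟨hE, hM⟩ := H.mem_ramQuadratics_of_le hL hwL (hL ▸ hw) hEL hE
    exact ⟨hE, _, hM, IntermediateField.extendScalars_restrictScalars hEL⟩
  · rintro ⟨hE, M, hM, rfl⟩
    have hEM : E ∈ quadSub (M.restrictScalars K) :=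
      ⟨fun x hx => M.algebraMap_mem ⟨x, hx⟩, hE.1⟩
    have hfour := finrank_restrictScalars_of_mem_ramQuadratics hE hM
    have : FiniteDimensional K (M.restrictScalars K) := .of_finrank_pos (by lia)
    exact ⟨⟨hfour, (isTotallyRamified_iff_exists_pow hϖ).2 (hfour ▸ H.exists_pow_four_eq hM),
      E, hEM⟩, hEM⟩

theorem finsum_inv_pow_discrVal_ramQuadratics {d : ℕ}
    (hE : E ∈ ramQuadratics K (closureAbs K) (baseAbs K ϖ))
    (hd : HasDisc (closureAbs K) (baseAbs K ϖ) E d) :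
    ∑ᶠ M ∈ ramQuadratics E (closureAbs K) √(baseAbs K ϖ),
      ((residueCard K : ℝ) ^ discrVal K (M.restrictScalars K))⁻¹ =
        2 * (residueCard K : ℝ)⁻¹ * (((residueCard K : ℝ) ^ d) ^ 2)⁻¹ := by
  obtain ⟨δ, hδ, hsum⟩ :=
    ((isDyadicBase hϖ).extend_of_mem_ramQuadratics hE).exists_disc_and_sum_ramQuadratics
  have hq : (residueCard K : ℝ) ≠ 0 := mod_cast (one_lt_residueCard K).ne_bot
  have htower (M) (hM : M ∈ ramQuadratics E (closureAbs K) √(baseAbs K ϖ)) :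
      ((residueCard K : ℝ) ^ discrVal K (M.restrictScalars K))⁻¹ =
        (((residueCard K : ℝ) ^ d) ^ 2)⁻¹ * ((residueCard K : ℝ) ^ δ M)⁻¹ := by
    rw [discrVal_tower hϖ hE hd hM (hδ M hM), pow_add, mul_inv, mul_comm 2 d, pow_mul]
  rw [finsum_mem_congr rfl htower,
    hsum fun n => (((residueCard K : ℝ) ^ d) ^ 2)⁻¹ * ((residueCard K : ℝ) ^ n)⁻¹,
    ← sum_inv_pow_disc hq (2 * absRamificationIdx K), add_mul, Finset.sum_mul]
  congr 1
  · ring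
  · exact Finset.sum_congr rfl fun i _ => by ring

end Uniformizer

variable (K) in
theorem finite_towerQuartics : (towerQuartics K).Finite := by
  obtain ⟨ϖ, hϖ⟩ := IsDiscreteValuationRing.exists_irreducible (integers K)
  have H := isDyadicBase hϖ
  refine (H.finite_ramQuadratics.biUnion fun E hE =>
    (H.extend_of_mem_ramQuadratics hE).finite_ramQuadratics.image
      (IntermediateField.restrictScalars K)).subset fun L hL => ?_
  obtain ⟨E, hE⟩ := hL.2.2
  obtain ⟨hE, hM⟩ := (mem_towerQuartics_and_mem_quadSub_iff hϖ).1 ⟨hL, hE⟩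
  exact Set.mem_biUnion hE hM

variable (K) in
theorem finsum_ncard_quadSub_mul_towerQuartics {q : ℝ} (hq : q = residueCard K) {e : ℤ}
    (he : e = absRamificationIdx K) :
    ∑ᶠ L ∈ towerQuartics K, ((quadSub L).ncard : ℝ) * (q ^ discrVal K L)⁻¹ =
      4 * (1 / (q ^ 2 + q + 1) * (q ^ (-3 * e - 3) + q ^ (-3 * e - 1) + q ^ (-2 : ℤ))) := by
  obtain ⟨ϖ, hϖ⟩ := IsDiscreteValuationRing.exists_irreducible (integers K)
  have H := isDyadicBase hϖ
  obtain ⟨δ, hδ, hsum⟩ := H.exists_disc_and_sum_ramQuadratics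
  have hq0 : 0 < q := by
    rw [hq]
    exact_mod_cast zero_lt_one.trans (one_lt_residueCard K)
  have hinner (E) (hE : E ∈ ramQuadratics K (closureAbs K) (baseAbs K ϖ)) :
      ∑ᶠ L ∈ IntermediateField.restrictScalars K '' ramQuadratics E (closureAbs K) √(baseAbs K ϖ),
        (q ^ discrVal K L)⁻¹ = 2 * q⁻¹ * ((q ^ δ E) ^ 2)⁻¹ := by
    rw [finsum_mem_image (IntermediateField.restrictScalars_injective K).injOn, hq,
      finsum_inv_pow_discrVal_ramQuadratics hϖ hE (hδ E hE)]
  rw [finsum_mem_ncard_mul_comm H.finite_ramQuadratics (finite_towerQuartics K)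
      (fun E L => mem_towerQuartics_and_mem_quadSub_iff hϖ), finsum_mem_congr rfl hinner,
    hsum fun d => 2 * q⁻¹ * ((q ^ d) ^ 2)⁻¹, ← hq]
  have hfour : (4 : ℝ) = 2 * q⁻¹ * (2 * q) := by
    field_simp
    norm_num
  rw [hfour, mul_assoc (2 * q⁻¹), he, ← sum_inv_sq_pow_disc hq0, mul_add, Finset.mul_sum]
  congr 1
  · ring
  · exact Finset.sum_congr rfl fun i _ => by ring

end Towers

section QuadSubCount

variable {K : Type*} [Field K] [PerfectField K] {L : IntermediateField K (AlgebraicClosure K)}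
  (hL : Module.finrank K L = 4)
include hL

theorem ncard_quadSub_of_mulEquiv_D4 (f : GaloisClosureGroup K L ≃* D4) :
    (quadSub L).ncard = 1 := by
  have : FiniteDimensional K L := .of_finrank_pos (by lia)
  rw [ncard_quadSub, ncard_indexTwo_D4 ((index_relGaloisGroup L).trans hL)
    (normalCore_relGaloisGroup L) f]

theorem ncard_quadSub_of_mulEquiv_C4 (f : GaloisClosureGroup K L ≃* C4) :
    (quadSub L).ncard = 1 := by
  have : FiniteDimensional K L := .of_finrank_pos (by lia)
  rw [ncard_quadSub, ncard_indexTwo_C4 ((index_relGaloisGroup L).trans hL)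
    (normalCore_relGaloisGroup L) f]

theorem ncard_quadSub_of_mulEquiv_V4 (f : GaloisClosureGroup K L ≃* V4) :
    (quadSub L).ncard = 3 := by
  have : FiniteDimensional K L := .of_finrank_pos (by lia)
  rw [ncard_quadSub, ncard_indexTwo_V4 ((index_relGaloisGroup L).trans hL) f]

theorem nonempty_galoisClosureGroup_mulEquiv_of_quadSub (hne : (quadSub L).Nonempty) :
    Nonempty (GaloisClosureGroup K L ≃* D4) ∨ Nonempty (GaloisClosureGroup K L ≃* C4) ∨
      Nonempty (GaloisClosureGroup K L ≃* V4) := by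
  have : FiniteDimensional K L := .of_finrank_pos (by lia)
  rw [quadSub_eq_image_indexTwo, Set.image_nonempty] at hne
  exact nonempty_mulEquiv_of_indexTwo_nonempty ((index_relGaloisGroup L).trans hL)
    (normalCore_relGaloisGroup L) hne

end QuadSubCount

section GaloisType

theorem isEmpty_D4_mulEquiv_C4 : IsEmpty (D4 ≃* C4) :=
  ⟨fun f => absurd (Nat.card_congr f.toEquiv) (by rw [DihedralGroup.nat_card]; simp)⟩

theorem isEmpty_D4_mulEquiv_V4 : IsEmpty (D4 ≃* V4) :=
  ⟨fun f => absurd (Nat.card_congr f.toEquiv) (by rw [DihedralGroup.nat_card]; simp)⟩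

theorem isEmpty_C4_mulEquiv_V4 : IsEmpty (C4 ≃* V4) :=
  ⟨fun f => IsKleinFour.not_isCyclic (isCyclic_of_surjective f f.surjective)⟩

variable (K : Type*) [Field K] [Algebra ℤ_[2] K]

/-- The totally ramified quartic extensions of `K` with a quadratic subextension whose Galois
closure has group `G`, as subfields of the algebraic closure rather than up to isomorphism. -/
def towerQuarticsOfType (G : Type*) [Group G] : Set (IntermediateField K (AlgebraicClosure K)) :=
  {L ∈ towerQuartics K | Nonempty (GaloisClosureGroup K L ≃* G)}

theorem disjoint_towerQuarticsOfType {G G' : Type*} [Group G] [Group G'] (h : IsEmpty (G ≃* G')) :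
    Disjoint (towerQuarticsOfType K G) (towerQuarticsOfType K G') :=
  Set.disjoint_left.2 fun _ ⟨_, ⟨f⟩⟩ ⟨_, ⟨f'⟩⟩ => h.false (f.symm.trans f')

theorem towerQuartics_eq_union [PerfectField K] : towerQuartics K =
    towerQuarticsOfType K D4 ∪ (towerQuarticsOfType K C4 ∪ towerQuarticsOfType K V4) := by
  ext L
  constructor
  · intro hL
    rcases nonempty_galoisClosureGroup_mulEquiv_of_quadSub hL.1 hL.2.2 with h | h | h
    exacts [.inl ⟨hL, h⟩, .inr (.inl ⟨hL, h⟩), .inr (.inr ⟨hL, h⟩)]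
  · rintro (h | h | h) <;> exact h.1

theorem finite_towerQuarticsOfType [Algebra ℚ_[2] K] [FiniteDimensional ℚ_[2] K]
    [IsScalarTower ℤ_[2] ℚ_[2] K] (G : Type*) [Group G] : (towerQuarticsOfType K G).Finite :=
  (finite_towerQuartics K).subset (Set.sep_subset _ _)

section QuarticsOfType

variable {G : Type*} [Group G] {n : ℕ} (hn : n ≠ 0)
  (hG : ∀ L : IntermediateField K (AlgebraicClosure K), Module.finrank K L = 4 →
    GaloisClosureGroup K L ≃* G → (quadSub L).ncard = n)
include hn hG

theorem quartics_eq_image :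
    quartics K G = Quotient.mk (extensionSetoid K) '' towerQuarticsOfType K G := by
  ext c
  constructor
  · rintro ⟨L, rfl, hL, hram, ⟨f⟩⟩
    have hne := Set.nonempty_of_ncard_ne_zero (hG L hL f ▸ hn)
    exact ⟨L, ⟨⟨hL, hram, hne⟩, ⟨f⟩⟩, rfl⟩
  · rintro ⟨L, ⟨hL, hf⟩, rfl⟩
    exact ⟨L, rfl, hL.1, hL.2.1, hf⟩

variable [Algebra ℚ_[2] K] [FiniteDimensional ℚ_[2] K] [IsScalarTower ℤ_[2] ℚ_[2] K]

theorem finite_quartics : (quartics K G).Finite :=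
  quartics_eq_image K hn hG ▸ (finite_towerQuarticsOfType K G).image _

theorem finsum_ncard_quadSub_mul_towerQuarticsOfType {q : ℝ} (hq : q = residueCard K) :
    ∑ᶠ L ∈ towerQuarticsOfType K G, ((quadSub L).ncard : ℝ) * (q ^ discrVal K L)⁻¹ =
      4 * (n * mass K (quartics K G)) := by
  have hconst (L) (hL : L ∈ towerQuarticsOfType K G) : ((quadSub L).ncard : ℝ) *
      (q ^ discrVal K L)⁻¹ = n * ((residueCard K : ℝ) ^ discrVal K L)⁻¹ := by
    obtain ⟨hL, ⟨f⟩⟩ := hL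
    rw [hG L hL.1 f, hq]
  have hconj (L) (hL : L ∈ towerQuarticsOfType K G)
      (L' : IntermediateField K (AlgebraicClosure K)) (hL' : Nonempty (L ≃ₐ[K] L')) :
      L' ∈ towerQuarticsOfType K G := by
    obtain ⟨⟨hL, ⟨f⟩⟩, ⟨g⟩⟩ := And.intro hL hL'
    obtain ⟨g'⟩ := nonempty_galoisClosureGroup_mulEquiv g
    exact ⟨mem_towerQuartics_of_algEquiv g hL, ⟨g'.symm.trans f⟩⟩
  rw [finsum_mem_congr rfl hconst, ← mul_finsum_mem, quartics_eq_image K hn hG,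
    mass_image (n := 4) (by lia) (finite_towerQuarticsOfType K G) (fun L hL => hL.1.1) hconj]
  push_cast
  ring

end QuarticsOfType

theorem finsum_towerQuartics [Algebra ℚ_[2] K] [FiniteDimensional ℚ_[2] K]
    [IsScalarTower ℤ_[2] ℚ_[2] K] {R : Type*} [AddCommMonoid R]
    (φ : IntermediateField K (AlgebraicClosure K) → R) :
    ∑ᶠ L ∈ towerQuartics K, φ L = ∑ᶠ L ∈ towerQuarticsOfType K D4, φ L +
      (∑ᶠ L ∈ towerQuarticsOfType K C4, φ L + ∑ᶠ L ∈ towerQuarticsOfType K V4, φ L) := by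
  have hfin := fun (G : Type) [Group G] => finite_towerQuarticsOfType K G
  rw [towerQuartics_eq_union, finsum_mem_union _ (hfin D4) ((hfin C4).union (hfin V4)),
    finsum_mem_union (disjoint_towerQuarticsOfType K isEmpty_C4_mulEquiv_V4) (hfin C4) (hfin V4)]
  exact Set.disjoint_union_right.2 ⟨disjoint_towerQuarticsOfType K isEmpty_D4_mulEquiv_C4,
    disjoint_towerQuarticsOfType K isEmpty_D4_mulEquiv_V4⟩

end GaloisType

end TwoAdic

theorem mainTheorem7 (K : Type*) [Field K] [Algebra ℚ_[2] K] [FiniteDimensional ℚ_[2] K]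
    [Algebra ℤ_[2] K] [IsScalarTower ℤ_[2] ℚ_[2] K] (q : ℝ) (hq : q = TwoAdic.residueCard K)
    (e : ℤ) (he : e = TwoAdic.absRamificationIdx K) :
    (TwoAdic.quartics K TwoAdic.D4).Finite ∧
    (TwoAdic.quartics K TwoAdic.C4).Finite ∧
    (TwoAdic.quartics K TwoAdic.V4).Finite ∧
    TwoAdic.mass K (TwoAdic.quartics K TwoAdic.D4) =
      1 / (q ^ 2 + q + 1) * (q ^ (-3 * e - 3) + q ^ (-3 * e - 1) + q ^ (-2 : ℤ))
        - TwoAdic.mass K (TwoAdic.quartics K TwoAdic.C4)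
        - 3 * TwoAdic.mass K (TwoAdic.quartics K TwoAdic.V4) := by
  open TwoAdic in
  have hD (L : IntermediateField K (AlgebraicClosure K)) (hL : Module.finrank K L = 4) :=
    ncard_quadSub_of_mulEquiv_D4 hL
  have hC (L : IntermediateField K (AlgebraicClosure K)) (hL : Module.finrank K L = 4) :=
    ncard_quadSub_of_mulEquiv_C4 hL
  have hV (L : IntermediateField K (AlgebraicClosure K)) (hL : Module.finrank K L = 4) :=
    ncard_quadSub_of_mulEquiv_V4 hL
  refine ⟨finite_quartics K one_ne_zero hD, finite_quartics K one_ne_zero hC,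
    finite_quartics K three_ne_zero hV, ?_⟩
  have hsum := finsum_ncard_quadSub_mul_towerQuartics K hq he
  rw [finsum_towerQuartics,
    finsum_ncard_quadSub_mul_towerQuarticsOfType K one_ne_zero hD hq,
    finsum_ncard_quadSub_mul_towerQuarticsOfType K one_ne_zero hC hq,
    finsum_ncard_quadSub_mul_towerQuarticsOfType K three_ne_zero hV hq] at hsum
  push_cast at hsum
  linear_combination (1 / 4 : ℝ) * hsum
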